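/- Let $T>0$, let $P,Q$ be compact metric spaces, and consider the differential game $$\dot x=f(t,x,u)+g(t,x,v),\qquad t\in[0,T],\ x\in\mathbb R^n,\ u\in P,\ v\in Q,$$ in which player I maximizes $\sigma_1(x(T))$ and player II maximizes $\sigma_2(x(T))$. The functions $f,g,\sigma_1,\sigma_2$ are continuous; $f$ and $g$ are Lipschitz continuous in $x$ on bounded sets, uniformly in the time and the control, and $\|f(t,x,u)\|+\|g(t,x,v)\|\le C(1+\|x\|)$ for some $C$. Let $\mathcal U,\mathcal V$ be the sets of measurable functions $[0,T]\to P$, $[0,T]\to Q$, and let $x(\cdot,t_0,x_0,u,v)$ be the solution on $[0,T]$ with $x(t_0)=x_0$. With closures in $C([0,T],\mathbb R^n)$ put $$\mathrm{Sol}(t_*,x_*)=\mathrm{cl}\{x(\cdot,t_*,x_*,u,v):u\in\mathcal U,v\in\mathcal V\},$$ $$\mathrm{Sol}^1(t_*,x_*;v_*)=\mathrm{cl}\{x(\cdot,t_*,x_*,u,v_*):u\in\mathcal U\},\qquad \mathrm{Sol}^2(t_*,x_*;u_*)=\mathrm{cl}\{x(\cdot,t_*,x_*,u_*,v):v\in\mathcal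 V\}$$ for $u_*\in P$, $v_*\in Q$ (constant controls). A control-with-guide strategy of player I is a triple $U=(u,\psi^1,\chi^1)$ of functions $u:[0,T]\times\mathbb R^n\times\mathbb R^m\to P$, $\psi^1:[0,T]\times[0,T]\times\mathbb R^n\times\mathbb R^m\to\mathbb R^m$, $\chi^1:[0,T]\times\mathbb R^n\to\mathbb R^m$, for some natural $m$; a strategy $V=(v,\psi^2,\chi^2)$ of player II is defined analogously, with values of $v$ in $Q$. Given $(t_0,x_0)$ and a partition $\Delta=\{t_0<t_1<\dots<t_r=T\}$ of fineness $d(\Delta)=\max_k(t_{k+1}-t_k)$, player I who uses $U$ applies the control $u(t_k,x[t_k],w^1_k)$ on $[t_k,t_{k+1})$, where $w^1_0=\chi^1(t_0,x_0)$ and $w^1_{k+1}=\psi^1(t_{k+1},t_k,x[t_k],w^1_k)$; likewise for player II. Let $x^1[\cdot,t_0,x_0,U,\Delta,v[\cdot]]$, $x^2[\cdot,t_0,x_0,V,\Delta,u[\cdot]]$, $x^{(c)}[\cdot,t_0,x_0,U,V,\Delta]$ be the motions with $x[t_0]=x_0$ on $[t_0,T]$ that arise when, respectively, I uses $U$ against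 $v[\cdot]\in\mathcal V$, II uses $V$ against $u[\cdot]\in\mathcal U$, and both use their strategies with the same partition. For $G\subset[0,T]\times\mathbb R^n$ the pair $(U,V)$ is a control-with-guide Nash equilibrium on $G$ if for all $(t_0,x_0)\in G$ $$\lim_{\delta\downarrow0}\sup\{\sigma_1(x^2[T,t_0,x_0,V,\Delta,u[\cdot]]):d(\Delta)\le\delta,\,u[\cdot]\in\mathcal U\}\le\lim_{\delta\downarrow0}\inf\{\sigma_1(x^{(c)}[T,t_0,x_0,U,V,\Delta]):d(\Delta)\le\delta\},$$ $$\lim_{\delta\downarrow0}\sup\{\sigma_2(x^1[T,t_0,x_0,U,\Delta,v[\cdot]]):d(\Delta)\le\delta,\,v[\cdot]\in\mathcal V\}\le\lim_{\delta\downarrow0}\inf\{\sigma_2(x^{(c)}[T,t_0,x_0,U,V,\Delta]):d(\Delta)\le\delta\}.$$ **Theorem.** Let a continuous function $(c_1,c_2):[0,T]\times\mathbb R^n\to\mathbb R^2$ satisfy: (F1) $c_i(T,x)=\sigma_i(x)$ for all $x\in\mathbb R^n$, $i=1,2$; (F2) for every $(t_*,x_*)\in[0,T]\times\mathbb R^n$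 and $u\in P$ there is $y^2(\cdot)\in\mathrm{Sol}^2(t_*,x_*;u)$ with $c_1(t,y^2(t))\le c_1(t_*,x_*)$ for all $t\in[t_*,T]$; (F3) for every $(t_*,x_*)\in[0,T]\times\mathbb R^n$ and $v\in Q$ there is $y^1(\cdot)\in\mathrm{Sol}^1(t_*,x_*;v)$ with $c_2(t,y^1(t))\le c_2(t_*,x_*)$ for all $t\in[t_*,T]$; (F4) for every $(t_*,x_*)\in[0,T]\times\mathbb R^n$ there is $y^{(c)}(\cdot)\in\mathrm{Sol}(t_*,x_*)$ with $c_i(t,y^{(c)}(t))=c_i(t_*,x_*)$ for all $t\in[t_*,T]$, $i=1,2$. Then for every compact $G\subset[0,T]\times\mathbb R^n$ there is a control-with-guide Nash equilibrium $(U,V)$ on $G$ whose payoff to player $i$ at each $(t_0,x_0)\in G$ is $c_i(t_0,x_0)$: both the infimum and the supremum of $\sigma_i(x^{(c)}[T,t_0,x_0,U,V,\Delta])$ over the partitions with $d(\Delta)\le\delta$ tend to $c_i(t_0,x_0)$ as $\delta\downarrow0$. -/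

import Mathlib

open Set Filter Topology MeasureTheory

/-- The phase space `ℝⁿ` with its Euclidean norm. -/
abbrev Vec (n : ℕ) : Type := EuclideanSpace ℝ (Fin n)

/-- A two-player differential game on `[0,T] × ℝⁿ` with dynamics `x' = f(t,x,u) + g(t,x,v)`,
`u ∈ P`, `v ∈ Q`, in which player I maximizes `σ₁(x(T))` and player II maximizes `σ₂(x(T))`.
The functions `f`, `g` are continuous, Lipschitz in `x` (uniformly in the time and the control)
on bounded sets, and of at most linear growth in `x`. Only the values of `f`, `g` at times in
`[0,T]` matter. -/
structure DifferentialGame (n : ℕ) (P Q : Type*) [MetricSpace P] [MetricSpace Q] where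
  T : ℝ
  f : ℝ → Vec n → P → Vec n
  g : ℝ → Vec n → Q → Vec n
  σ₁ : Vec n → ℝ
  σ₂ : Vec n → ℝ
  T_pos : 0 < T
  continuousOn_f :
    ContinuousOn (fun p : ℝ × Vec n × P => f p.1 p.2.1 p.2.2) (Icc 0 T ×ˢ univ)
  continuousOn_g :
    ContinuousOn (fun p : ℝ × Vec n × Q => g p.1 p.2.1 p.2.2) (Icc 0 T ×ˢ univ)
  continuous_σ₁ : Continuous σ₁
  continuous_σ₂ : Continuous σ₂
  lipschitz_f : ∀ R : ℝ, ∃ L : ℝ, ∀ t ∈ Icc 0 T, ∀ x y : Vec n, ‖x‖ ≤ R → ‖y‖ ≤ R →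
    ∀ u : P, ‖f t x u - f t y u‖ ≤ L * ‖x - y‖
  lipschitz_g : ∀ R : ℝ, ∃ L : ℝ, ∀ t ∈ Icc 0 T, ∀ x y : Vec n, ‖x‖ ≤ R → ‖y‖ ≤ R →
    ∀ v : Q, ‖g t x v - g t y v‖ ≤ L * ‖x - y‖
  growth_f : ∃ C : ℝ, ∀ t ∈ Icc 0 T, ∀ (x : Vec n) (u : P), ‖f t x u‖ ≤ C * (1 + ‖x‖)
  growth_g : ∃ C : ℝ, ∀ t ∈ Icc 0 T, ∀ (x : Vec n) (v : Q), ‖g t x v‖ ≤ C * (1 + ‖x‖)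

/-- A control-with-guide strategy with values in the control set `A`: a natural number `m` (the
dimension of the guide), the control function of the position and the guide, the rule
`transition t₊ t x w` for the state of the guide at time `t₊` when at time `t` the phase vector is
`x` and the state of the guide is `w`, and the initial state of the guide. -/
structure GuideStrategy (n : ℕ) (A : Type*) where
  m : ℕ
  control : ℝ → Vec n → Vec m → A
  transition : ℝ → ℝ → Vec n → Vec m → Vec m
  initial : ℝ → Vec n → Vec m

/-- A partition `a = t 0 < t 1 < ... < t r = b` of `[a,b]`. The values `t k` with `k > r` are
irrelevant, and `r = 0` happens exactly when `a = b`. -/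
structure TimePartition (a b : ℝ) where
  r : ℕ
  t : ℕ → ℝ
  t_zero : t 0 = a
  t_last : t r = b
  t_lt : ∀ k < r, t k < t (k + 1)

/-- The fineness `d(Δ)`, the greatest length of a step (zero if there is no step). -/
noncomputable def TimePartition.mesh {a b : ℝ} (Δ : TimePartition a b) : ℝ :=
  ⨆ k : Fin Δ.r, (Δ.t ((k : ℕ) + 1) - Δ.t (k : ℕ))

namespace GuideStrategy

variable {n : ℕ} {A : Type*}

/-- The states `w 0, w 1, ...` of the guide at the times of the partition, computed from the
observed states `x (t 0), x (t 1), ...` of the system. -/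
def guide (S : GuideStrategy n A) (t : ℕ → ℝ) (x : ℝ → Vec n) : ℕ → Vec S.m
  | 0 => S.initial (t 0) (x (t 0))
  | k + 1 => S.transition (t (k + 1)) (t k) (x (t k)) (S.guide t x k)

/-- The control `u` is the stepwise control formed by the strategy `S` along `x`. -/
def Forms (S : GuideStrategy n A) {a b : ℝ} (Δ : TimePartition a b) (x : ℝ → Vec n)
    (u : ℝ → A) : Prop :=
  ∀ k < Δ.r, ∀ s ∈ Ico (Δ.t k) (Δ.t (k + 1)),
    u s = S.control (Δ.t k) (x (Δ.t k)) (S.guide Δ.t x k)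

end GuideStrategy

namespace DifferentialGame

variable {n : ℕ} {P Q : Type*} [MetricSpace P] [MetricSpace Q]

/-- `x` is, on the interval `I` that contains `t₀`, the (Caratheodory) solution of
`x' = f(t,x,u(t)) + g(t,x,v(t))`, `x(t₀) = x₀`. -/
def IsMotion (Γ : DifferentialGame n P Q) (I : Set ℝ) (t₀ : ℝ) (x₀ : Vec n)
    (u : ℝ → P) (v : ℝ → Q) (x : ℝ → Vec n) : Prop :=
  ContinuousOn x I ∧
  IntegrableOn (fun s => Γ.f s (x s) (u s) + Γ.g s (x s) (v s)) I ∧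
  ∀ t ∈ I, x t = x₀ + ∫ s in t₀..t, (Γ.f s (x s) (u s) + Γ.g s (x s) (v s))

/-- `Sol(t₀,x₀)`: the closure, in the space of continuous functions on `[0,T]` with the uniform
norm, of the set of the motions generated by the measurable controls of both players. -/
def sol (Γ : DifferentialGame n P Q) [MeasurableSpace P] [MeasurableSpace Q]
    (t₀ : ℝ) (x₀ : Vec n) : Set C(Icc (0 : ℝ) Γ.T, Vec n) :=
  closure {y | ∃ (u : ℝ → P) (v : ℝ → Q) (x : ℝ → Vec n), Measurable u ∧ Measurable v ∧
    Γ.IsMotion (Icc 0 Γ.T) t₀ x₀ u v x ∧ ∀ t : Icc (0 : ℝ) Γ.T, y t = x t}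

/-- `Sol¹(t₀,x₀;v)`: player II uses the constant control `v`. -/
def sol₁ (Γ : DifferentialGame n P Q) [MeasurableSpace P]
    (t₀ : ℝ) (x₀ : Vec n) (v : Q) : Set C(Icc (0 : ℝ) Γ.T, Vec n) :=
  closure {y | ∃ (u : ℝ → P) (x : ℝ → Vec n), Measurable u ∧
    Γ.IsMotion (Icc 0 Γ.T) t₀ x₀ u (fun _ => v) x ∧ ∀ t : Icc (0 : ℝ) Γ.T, y t = x t}

/-- `Sol²(t₀,x₀;u)`: player I uses the constant control `u`. -/
def sol₂ (Γ : DifferentialGame n P Q) [MeasurableSpace Q]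
    (t₀ : ℝ) (x₀ : Vec n) (u : P) : Set C(Icc (0 : ℝ) Γ.T, Vec n) :=
  closure {y | ∃ (v : ℝ → Q) (x : ℝ → Vec n), Measurable v ∧
    Γ.IsMotion (Icc 0 Γ.T) t₀ x₀ (fun _ => u) v x ∧ ∀ t : Icc (0 : ℝ) Γ.T, y t = x t}

/-- `x = x¹[·,t₀,x₀,U,Δ,v]`: player I uses the strategy `U`, player II the control `v`. -/
def IsStepMotion₁ (Γ : DifferentialGame n P Q) (t₀ : ℝ) (x₀ : Vec n) (U : GuideStrategy n P)
    (Δ : TimePartition t₀ Γ.T) (v : ℝ → Q) (x : ℝ → Vec n) : Prop :=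
  ∃ u : ℝ → P, U.Forms Δ x u ∧ Γ.IsMotion (Icc t₀ Γ.T) t₀ x₀ u v x

/-- `x = x²[·,t₀,x₀,V,Δ,u]`: player II uses the strategy `V`, player I the control `u`. -/
def IsStepMotion₂ (Γ : DifferentialGame n P Q) (t₀ : ℝ) (x₀ : Vec n) (V : GuideStrategy n Q)
    (Δ : TimePartition t₀ Γ.T) (u : ℝ → P) (x : ℝ → Vec n) : Prop :=
  ∃ v : ℝ → Q, V.Forms Δ x v ∧ Γ.IsMotion (Icc t₀ Γ.T) t₀ x₀ u v x

/-- `x = x⁽ᶜ⁾[·,t₀,x₀,U,V,Δ]`: both players use their strategies, with the same partition. -/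
def IsJointMotion (Γ : DifferentialGame n P Q) (t₀ : ℝ) (x₀ : Vec n) (U : GuideStrategy n P)
    (V : GuideStrategy n Q) (Δ : TimePartition t₀ Γ.T) (x : ℝ → Vec n) : Prop :=
  ∃ (u : ℝ → P) (v : ℝ → Q), U.Forms Δ x u ∧ V.Forms Δ x v ∧
    Γ.IsMotion (Icc t₀ Γ.T) t₀ x₀ u v x

/-- The values `σ₂(x¹[T,t₀,x₀,U,Δ,v])` over `d(Δ) ≤ δ` and measurable controls `v`. -/
def payoffs₁ (Γ : DifferentialGame n P Q) [MeasurableSpace Q] (t₀ : ℝ) (x₀ : Vec n)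
    (U : GuideStrategy n P) (δ : ℝ) : Set EReal :=
  {p | ∃ (Δ : TimePartition t₀ Γ.T) (v : ℝ → Q) (x : ℝ → Vec n), Δ.mesh ≤ δ ∧ Measurable v ∧
    Γ.IsStepMotion₁ t₀ x₀ U Δ v x ∧ p = (Γ.σ₂ (x Γ.T) : EReal)}

/-- The values `σ₁(x²[T,t₀,x₀,V,Δ,u])` over `d(Δ) ≤ δ` and measurable controls `u`. -/
def payoffs₂ (Γ : DifferentialGame n P Q) [MeasurableSpace P] (t₀ : ℝ) (x₀ : Vec n)
    (V : GuideStrategy n Q) (δ : ℝ) : Set EReal :=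
  {p | ∃ (Δ : TimePartition t₀ Γ.T) (u : ℝ → P) (x : ℝ → Vec n), Δ.mesh ≤ δ ∧ Measurable u ∧
    Γ.IsStepMotion₂ t₀ x₀ V Δ u x ∧ p = (Γ.σ₁ (x Γ.T) : EReal)}

/-- The values `σ(x⁽ᶜ⁾[T,t₀,x₀,U,V,Δ])` over `d(Δ) ≤ δ`. -/
def jointPayoffs (Γ : DifferentialGame n P Q) (σ : Vec n → ℝ) (t₀ : ℝ) (x₀ : Vec n)
    (U : GuideStrategy n P) (V : GuideStrategy n Q) (δ : ℝ) : Set EReal :=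
  {p | ∃ (Δ : TimePartition t₀ Γ.T) (x : ℝ → Vec n), Δ.mesh ≤ δ ∧
    Γ.IsJointMotion t₀ x₀ U V Δ x ∧ p = (σ (x Γ.T) : EReal)}

/-- `(U,V)` is a control-with-guide Nash equilibrium on `G`. The suprema and infima are taken in
the extended reals, where all the limits exist by monotonicity in `δ`. -/
def IsGuideNash (Γ : DifferentialGame n P Q) [MeasurableSpace P] [MeasurableSpace Q]
    (G : Set (ℝ × Vec n)) (U : GuideStrategy n P) (V : GuideStrategy n Q) : Prop :=
  ∀ (t₀ : ℝ) (x₀ : Vec n), (t₀, x₀) ∈ G →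
    (∃ a b : EReal,
      Tendsto (fun δ : ℝ => sSup (Γ.payoffs₂ t₀ x₀ V δ)) (𝓝[>] 0) (𝓝 a) ∧
      Tendsto (fun δ : ℝ => sInf (Γ.jointPayoffs Γ.σ₁ t₀ x₀ U V δ)) (𝓝[>] 0) (𝓝 b) ∧
      a ≤ b) ∧
    (∃ a b : EReal,
      Tendsto (fun δ : ℝ => sSup (Γ.payoffs₁ t₀ x₀ U δ)) (𝓝[>] 0) (𝓝 a) ∧
      Tendsto (fun δ : ℝ => sInf (Γ.jointPayoffs Γ.σ₂ t₀ x₀ U V δ)) (𝓝[>] 0) (𝓝 b) ∧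
      a ≤ b)

/-- For the terminal payoff function `σ`, the payoff at `(t₀,x₀)` of the joint motions generated
by `(U,V)` is `c`: the payoffs tend to `c` as the partition is refined, that is, both their
infimum and their supremum over `d(Δ) ≤ δ` tend to `c` as `δ ↓ 0`. -/
def HasPayoff (Γ : DifferentialGame n P Q) (σ : Vec n → ℝ) (t₀ : ℝ) (x₀ : Vec n)
    (U : GuideStrategy n P) (V : GuideStrategy n Q) (c : ℝ) : Prop :=
  Tendsto (fun δ : ℝ => sInf (Γ.jointPayoffs σ t₀ x₀ U V δ)) (𝓝[>] 0) (𝓝 (c : EReal)) ∧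
  Tendsto (fun δ : ℝ => sSup (Γ.jointPayoffs σ t₀ x₀ U V δ)) (𝓝[>] 0) (𝓝 (c : EReal))

end DifferentialGame

/-! The equilibrium consists of an agreement backed by threats. From each initial position (F4)
gives an agreed path along which both values stay constant, so by (F1) its terminal payoffs are the
required ones. The guide of each player remembers the initial position, a flag and one phase point.
As long as no deviation has been observed, both players aim the system at the agreed path, and the
guide stores the state predicted for the next partition time. Uniqueness of motions makes this
prediction exact, and both players compute it by the same rule. Hence along a joint motion no flag
is ever raised and the system tracks the path (`jointMotion_bound`).

If the observed state differs from the predicted one, the opponent has deviated during the last step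
only, so the system is still near the agreed path and, by continuity, the deviator's value exceeds
the agreed one by little. The other player then starts a model at the observed state, moves it along
the motions of (F3) (or (F2)), on which the deviator's value does not grow, and keeps the system
near the model (`triggerStrategy_bound`). A deviation that meets the predictions at the partition
times goes unnoticed, but is harmless: the system is still near the path at those times.

Tracking is extremal aiming in the sense of Krasovskii and Subbotin. Let `e` be the vector from the
model to the system. Player I minimizes the component of `f` along `e`, and the model is given the
constant control of player II that maximizes the component of `g` along `e`. Since the velocity is
the sum of `f` and `g`, the two velocities are then separated along `e` whatever player II really
does. So in a step of length `h` the squared distance is multiplied by at most `1 + K * h` and gains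
at most `ε * h` (`exists_aimStep_bound`); `exists_tolerance` accumulates these errors. Player II is
treated by exchanging the players. -/

theorem le_mul_exp_of_le_add_integral {φ : ℝ → ℝ} {a b A C : ℝ} (hab : a ≤ b) (hC : 0 ≤ C)
    (hφ : ContinuousOn φ (Icc a b))
    (h : ∀ t ∈ Icc a b, φ t ≤ A + C * ∫ s in a..t, φ s) :
    ∀ t ∈ Icc a b, φ t ≤ A * Real.exp (C * (t - a)) := by
  -- Extending `φ` by constants makes the integral differentiable at every point, including the ends
  -- of the interval.
  set ψ : ℝ → ℝ := IccExtend hab ((Icc a b).domRestrict φ) with hψ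
  have hψc : Continuous ψ := hφ.domRestrict.Icc_extend'
  have hψφ : ∀ t ∈ Icc a b, ψ t = φ t := fun t ht => by
    rw [hψ, IccExtend_of_mem hab _ ht]; rfl
  have hint : ∀ t ∈ Icc a b, ∫ s in a..t, φ s = ∫ s in a..t, ψ s := fun t ht => by
    refine intervalIntegral.integral_congr fun s hs => ?_
    rw [uIcc_of_le ht.1] at hs
    exact (hψφ s ⟨hs.1, hs.2.trans ht.2⟩).symm
  have hder : ∀ t, HasDerivAt (fun t => A + C * ∫ s in a..t, ψ s) (C * ψ t) t := fun t =>
    ((hψc.integral_hasStrictDerivAt a t).hasDerivAt.const_mul C).const_add A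
  have key := le_gronwallBound_of_liminf_deriv_right_le (f := fun t => A + C * ∫ s in a..t, ψ s)
    (f' := fun t => C * ψ t) (δ := A) (K := C) (ε := 0) (a := a) (b := b)
    (fun t _ => (hder t).continuousAt.continuousWithinAt)
    (fun t _ r hr => by
      have := (hder t).hasDerivWithinAt.liminf_right_slope_le hr
      simpa [slope_def_field, div_eq_inv_mul] using this)
    (by simp)
    (fun t ht => by
      have ht' := Ico_subset_Icc_self ht
      rw [add_zero, ← hint t ht', hψφ t ht']
      exact mul_le_mul_of_nonneg_left (h t ht') hC)
  intro t ht
  refine (h t ht).trans ?_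
  have := key t ht
  rwa [gronwallBound_ε0, ← hint t ht] at this

/-! ### Exchange of the players and uniform estimates for the velocities -/

namespace DifferentialGame

variable {n : ℕ} {P Q : Type*} [MetricSpace P] [MetricSpace Q]

/-- The game in which the players have changed places. -/
def swap (Γ : DifferentialGame n P Q) : DifferentialGame n Q P where
  T := Γ.T
  f := Γ.g
  g := Γ.f
  σ₁ := Γ.σ₂
  σ₂ := Γ.σ₁
  T_pos := Γ.T_pos
  continuousOn_f := Γ.continuousOn_g
  continuousOn_g := Γ.continuousOn_f
  continuous_σ₁ := Γ.continuous_σ₂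
  continuous_σ₂ := Γ.continuous_σ₁
  lipschitz_f := Γ.lipschitz_g
  lipschitz_g := Γ.lipschitz_f
  growth_f := Γ.growth_g
  growth_g := Γ.growth_f

theorem isMotion_swap (Γ : DifferentialGame n P Q) {I : Set ℝ} {t₀ : ℝ} {x₀ : Vec n}
    {u : ℝ → P} {v : ℝ → Q} {x : ℝ → Vec n} :
    Γ.swap.IsMotion I t₀ x₀ v u x ↔ Γ.IsMotion I t₀ x₀ u v x := by
  simp only [IsMotion, swap, add_comm]

theorem sol₁_swap (Γ : DifferentialGame n P Q) [MeasurableSpace Q] (t₀ : ℝ) (x₀ : Vec n) (u : P) :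
    Γ.swap.sol₁ t₀ x₀ u = Γ.sol₂ t₀ x₀ u := by
  simp only [sol₁, sol₂, isMotion_swap]
  rfl

theorem payoffs₁_swap (Γ : DifferentialGame n P Q) [MeasurableSpace P] (t₀ : ℝ) (x₀ : Vec n)
    (V : GuideStrategy n Q) (δ : ℝ) : Γ.swap.payoffs₁ t₀ x₀ V δ = Γ.payoffs₂ t₀ x₀ V δ := by
  simp only [payoffs₁, payoffs₂, IsStepMotion₁, IsStepMotion₂, isMotion_swap]
  rfl

/-- Linear growth of the total velocity. -/
theorem exists_growth (Γ : DifferentialGame n P Q) : ∃ C : ℝ, 0 ≤ C ∧ ∀ t ∈ Icc 0 Γ.T,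
    ∀ (x : Vec n) (u : P) (v : Q), ‖Γ.f t x u + Γ.g t x v‖ ≤ C * (1 + ‖x‖) := by
  obtain ⟨C₁, h₁⟩ := Γ.growth_f
  obtain ⟨C₂, h₂⟩ := Γ.growth_g
  refine ⟨|C₁| + |C₂|, by positivity, fun t ht x u v => (norm_add_le _ _).trans ?_⟩
  have hx : 0 ≤ 1 + ‖x‖ := by positivity
  have := mul_le_mul_of_nonneg_right (le_abs_self C₁) hx
  have := mul_le_mul_of_nonneg_right (le_abs_self C₂) hx
  linarith [h₁ t ht x u, h₂ t ht x v]

theorem exists_lipschitz (Γ : DifferentialGame n P Q) (R : ℝ) : ∃ L : ℝ, 0 ≤ L ∧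
    ∀ t ∈ Icc 0 Γ.T, ∀ x y : Vec n, ‖x‖ ≤ R → ‖y‖ ≤ R → ∀ (u : P) (v : Q),
      ‖(Γ.f t x u + Γ.g t x v) - (Γ.f t y u + Γ.g t y v)‖ ≤ L * ‖x - y‖ := by
  obtain ⟨L₁, h₁⟩ := Γ.lipschitz_f R
  obtain ⟨L₂, h₂⟩ := Γ.lipschitz_g R
  refine ⟨|L₁| + |L₂|, by positivity, fun t ht x y hx hy u v => ?_⟩
  rw [add_sub_add_comm]
  refine (norm_add_le _ _).trans ?_
  have hxy : 0 ≤ ‖x - y‖ := by positivity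
  have := mul_le_mul_of_nonneg_right (le_abs_self L₁) hxy
  have := mul_le_mul_of_nonneg_right (le_abs_self L₂) hxy
  linarith [h₁ t ht x y hx hy u, h₂ t ht x y hx hy v]

theorem exists_modulus_f (Γ : DifferentialGame n P Q) [CompactSpace P] (R : ℝ) {ε : ℝ}
    (hε : 0 < ε) : ∃ δ > 0, ∀ s ∈ Icc 0 Γ.T, ∀ t ∈ Icc 0 Γ.T, |s - t| ≤ δ → ∀ x : Vec n, ‖x‖ ≤ R →
      ∀ u : P, ‖Γ.f s x u - Γ.f t x u‖ ≤ ε := by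
  have hK : IsCompact (Icc 0 Γ.T ×ˢ (Metric.closedBall (0 : Vec n) R ×ˢ (univ : Set P))) :=
    isCompact_Icc.prod ((isCompact_closedBall _ _).prod isCompact_univ)
  have := hK.uniformContinuousOn_of_continuous
    (Γ.continuousOn_f.mono (prod_mono_right (subset_univ _)))
  rw [Metric.uniformContinuousOn_iff] at this
  obtain ⟨δ, hδ, h⟩ := this ε hε
  refine ⟨δ / 2, half_pos hδ, fun s hs t ht hst x hx u => ?_⟩
  have := h (s, x, u) ⟨hs, by simpa using hx, mem_univ _⟩ (t, x, u)
    ⟨ht, by simpa using hx, mem_univ _⟩ (by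
      simp only [Prod.dist_eq, dist_self, Real.dist_eq]
      rw [max_lt_iff]
      exact ⟨by linarith, by simpa using hδ⟩)
  rw [dist_eq_norm] at this
  exact this.le

theorem exists_modulus (Γ : DifferentialGame n P Q) [CompactSpace P] [CompactSpace Q] (R : ℝ)
    {ε : ℝ} (hε : 0 < ε) : ∃ δ > 0, ∀ s ∈ Icc 0 Γ.T, ∀ t ∈ Icc 0 Γ.T, |s - t| ≤ δ →
      ∀ x : Vec n, ‖x‖ ≤ R → ∀ (u : P) (v : Q),
        ‖(Γ.f s x u + Γ.g s x v) - (Γ.f t x u + Γ.g t x v)‖ ≤ ε := by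
  obtain ⟨δ₁, hδ₁, h₁⟩ := Γ.exists_modulus_f R (half_pos hε)
  obtain ⟨δ₂, hδ₂, h₂⟩ := Γ.swap.exists_modulus_f R (half_pos hε)
  refine ⟨min δ₁ δ₂, lt_min hδ₁ hδ₂, fun s hs t ht hst x hx u v => ?_⟩
  rw [add_sub_add_comm]
  refine (norm_add_le _ _).trans ?_
  have := h₁ s hs t ht (hst.trans (min_le_left _ _)) x hx u
  have := h₂ s hs t ht (hst.trans (min_le_right _ _)) x hx v
  simp only [swap] at this
  linarith

/-! ### Motions: restriction, growth, uniqueness, existence, gluing -/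

theorem IsMotion.apply_start {Γ : DifferentialGame n P Q} {I : Set ℝ} {t₀ : ℝ} {x₀ : Vec n}
    {u : ℝ → P} {v : ℝ → Q} {x : ℝ → Vec n} (h : Γ.IsMotion I t₀ x₀ u v x) (ht : t₀ ∈ I) :
    x t₀ = x₀ := by
  simpa using h.2.2 t₀ ht

/-- The restriction of a motion to a smaller interval. -/
theorem IsMotion.restrict {Γ : DifferentialGame n P Q} {c d t₀ a b : ℝ} {x₀ : Vec n}
    {u : ℝ → P} {v : ℝ → Q} {x : ℝ → Vec n} (h : Γ.IsMotion (Icc c d) t₀ x₀ u v x)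
    (ht₀ : t₀ ∈ Icc c d) (hca : c ≤ a) (hab : a ≤ b) (hbd : b ≤ d) :
    Γ.IsMotion (Icc a b) a (x a) u v x := by
  have hsub : Icc a b ⊆ Icc c d := Icc_subset_Icc hca hbd
  have hii : ∀ p ∈ Icc c d, ∀ q ∈ Icc c d,
      IntervalIntegrable (fun s => Γ.f s (x s) (u s) + Γ.g s (x s) (v s)) volume p q :=
    fun p hp q hq => (h.2.1.mono_set (uIcc_subset_Icc hp hq)).intervalIntegrable
  have ha : a ∈ Icc c d := ⟨hca, hab.trans hbd⟩
  refine ⟨h.1.mono hsub, h.2.1.mono_set hsub, fun t ht => ?_⟩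
  rw [h.2.2 t (hsub ht), h.2.2 a ha, add_assoc,
    intervalIntegral.integral_add_adjacent_intervals (hii _ ht₀ _ ha) (hii _ ha _ (hsub ht))]

theorem IsMotion.intervalIntegrable {Γ : DifferentialGame n P Q} {a b : ℝ} {x₀ : Vec n}
    {u : ℝ → P} {v : ℝ → Q} {x : ℝ → Vec n} (h : Γ.IsMotion (Icc a b) a x₀ u v x)
    {t : ℝ} (ht : t ∈ Icc a b) :
    IntervalIntegrable (fun s => Γ.f s (x s) (u s) + Γ.g s (x s) (v s)) volume a t :=
  (h.2.1.mono_set (uIcc_subset_Icc ⟨le_rfl, ht.1.trans ht.2⟩ ht)).intervalIntegrable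

theorem IsMotion.growth {Γ : DifferentialGame n P Q} {a b C : ℝ} {x₀ : Vec n}
    {u : ℝ → P} {v : ℝ → Q} {x : ℝ → Vec n} (h : Γ.IsMotion (Icc a b) a x₀ u v x)
    (ha : 0 ≤ a) (hab : a ≤ b) (hb : b ≤ Γ.T) (hC : 0 ≤ C)
    (hgr : ∀ t ∈ Icc 0 Γ.T, ∀ (x : Vec n) (u : P) (v : Q),
      ‖Γ.f t x u + Γ.g t x v‖ ≤ C * (1 + ‖x‖)) :
    ∀ t ∈ Icc a b, 1 + ‖x t‖ ≤ (1 + ‖x₀‖) * Real.exp (C * (t - a)) := by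
  have hc : ContinuousOn (fun t => 1 + ‖x t‖) (Icc a b) := continuousOn_const.add h.1.norm
  refine le_mul_exp_of_le_add_integral hab hC hc fun t ht => ?_
  have hci : IntervalIntegrable (fun t => C * (1 + ‖x t‖)) volume a t :=
    ((continuousOn_const.mul hc).mono (by
      rw [uIcc_of_le ht.1]; exact Icc_subset_Icc_right ht.2)).intervalIntegrable
  have h1 : ‖∫ s in a..t, (Γ.f s (x s) (u s) + Γ.g s (x s) (v s))‖ ≤
      ∫ s in a..t, C * (1 + ‖x s‖) :=
    intervalIntegral.norm_integral_le_of_norm_le ht.1 (Eventually.of_forall fun s hs =>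
      hgr s ⟨ha.trans hs.1.le, (hs.2.trans ht.2).trans hb⟩ _ _ _) hci
  rw [intervalIntegral.integral_const_mul] at h1
  have h2 := norm_add_le x₀ (∫ s in a..t, (Γ.f s (x s) (u s) + Γ.g s (x s) (v s)))
  rw [← h.2.2 t ht] at h2
  linarith

/-- A motion is determined by its initial state and by the controls. -/
theorem IsMotion.unique {Γ : DifferentialGame n P Q} {a b : ℝ} {x₀ : Vec n}
    {u u' : ℝ → P} {v v' : ℝ → Q} {x x' : ℝ → Vec n} (h : Γ.IsMotion (Icc a b) a x₀ u v x)
    (h' : Γ.IsMotion (Icc a b) a x₀ u' v' x')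
    (ha : 0 ≤ a) (hab : a ≤ b) (hb : b ≤ Γ.T) (hu : ∀ s ∈ Ico a b, u s = u' s)
    (hv : ∀ s ∈ Ico a b, v s = v' s) : ∀ t ∈ Icc a b, x t = x' t := by
  obtain ⟨R, hR⟩ := (isCompact_Icc.image_of_continuousOn h.1).isBounded.exists_norm_le
  obtain ⟨R', hR'⟩ := (isCompact_Icc.image_of_continuousOn h'.1).isBounded.exists_norm_le
  obtain ⟨L, hL, hlip⟩ := Γ.exists_lipschitz (max R R')
  have hc : ContinuousOn (fun t => ‖x t - x' t‖) (Icc a b) := (h.1.sub h'.1).norm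
  have key := le_mul_exp_of_le_add_integral (A := 0) hab hL hc fun t ht => by
    have hci : IntervalIntegrable (fun t => L * ‖x t - x' t‖) volume a t :=
      ((continuousOn_const.mul hc).mono (by
        rw [uIcc_of_le ht.1]; exact Icc_subset_Icc_right ht.2)).intervalIntegrable
    rw [h.2.2 t ht, h'.2.2 t ht, add_sub_add_left_eq_sub, zero_add,
      ← intervalIntegral.integral_const_mul,
      ← intervalIntegral.integral_sub (h.intervalIntegrable ht) (h'.intervalIntegrable ht)]
    refine intervalIntegral.norm_integral_le_of_norm_le ht.1 ?_ hci
    -- The controls are only known to agree before `b`; a single point does not affect the integral.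
    have hne : ∀ᵐ s : ℝ, s ≠ b := by simp [ae_iff, measure_singleton]
    filter_upwards [hne] with s hsb hs
    have hs' : s ∈ Ico a b := ⟨hs.1.le, lt_of_le_of_ne (hs.2.trans ht.2) hsb⟩
    have hs'' := Ico_subset_Icc_self hs'
    rw [hu s hs', hv s hs']
    exact hlip s ⟨ha.trans hs''.1, hs''.2.trans hb⟩ _ _
      ((hR _ (mem_image_of_mem x hs'')).trans (le_max_left _ _))
      ((hR' _ (mem_image_of_mem x' hs'')).trans (le_max_right _ _)) _ _
  intro t ht
  have := key t ht
  rw [zero_mul] at this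
  exact sub_eq_zero.1 (norm_le_zero_iff.1 this)

/-- Constant controls generate a motion on every short interval, whose length may be chosen
independently of the initial state because of the linear growth. -/
theorem exists_isMotion_const (Γ : DifferentialGame n P Q) : ∃ h > 0, ∀ a b : ℝ, 0 ≤ a → a ≤ b →
    b ≤ Γ.T → b - a ≤ h → ∀ (x₀ : Vec n) (u : P) (v : Q), ∃ x : ℝ → Vec n,
      Γ.IsMotion (Icc a b) a x₀ (fun _ => u) (fun _ => v) x := by
  obtain ⟨C, hC, hgr⟩ := Γ.exists_growth
  -- In the ball of radius `ρ = 1 + ‖x₀‖` about `x₀` the speed is at most `2 * C * ρ`, so the motion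
  -- cannot leave it within this time. Since `ρ` cancels, the time does not depend on `x₀`.
  refine ⟨1 / (2 * C + 1), by positivity, fun a b ha hab hb hh x₀ u v => ?_⟩
  set F : ℝ → Vec n → Vec n := fun t x => Γ.f t x u + Γ.g t x v with hF
  have hsub : ∀ t ∈ Icc a b, t ∈ Icc 0 Γ.T := fun t ht => ⟨ha.trans ht.1, ht.2.trans hb⟩
  have hcont : ∀ y : ℝ → Vec n, ContinuousOn y (Icc a b) →
      ContinuousOn (fun t => F t (y t)) (Icc a b) := fun y hy =>
    (Γ.continuousOn_f.comp (f := fun t => (t, y t, u))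
      (continuousOn_id.prodMk (hy.prodMk continuousOn_const))
      fun t ht => ⟨hsub t ht, mem_univ _⟩).add
    (Γ.continuousOn_g.comp (f := fun t => (t, y t, v))
      (continuousOn_id.prodMk (hy.prodMk continuousOn_const))
      fun t ht => ⟨hsub t ht, mem_univ _⟩)
  set ρ : ℝ := 1 + ‖x₀‖ with hρ
  have hρ0 : 0 ≤ ρ := by positivity
  have hball : ∀ x ∈ Metric.closedBall x₀ ρ, ‖x‖ ≤ ‖x₀‖ + ρ := fun x hx => by
    have := norm_le_norm_add_norm_sub' x x₀
    rw [mem_closedBall_iff_norm] at hx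
    linarith
  obtain ⟨K, hK, hlip⟩ := Γ.exists_lipschitz (‖x₀‖ + ρ)
  have hpl : IsPicardLindelof F (⟨a, le_rfl, hab⟩ : Icc a b) x₀ ⟨ρ, hρ0⟩ 0
      ⟨2 * C * ρ, by positivity⟩ ⟨K, hK⟩ := by
    refine ⟨fun t ht => LipschitzOnWith.of_dist_le_mul fun x hx y hy => ?_,
      fun x _ => hcont (fun _ => x) continuousOn_const, fun t ht x hx => ?_, ?_⟩
    · rw [dist_eq_norm, dist_eq_norm]
      exact hlip t (hsub t ht) x y (hball x hx) (hball y hy) u v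
    · refine (hgr t (hsub t ht) x u v).trans ?_
      have := hball x hx
      change _ ≤ 2 * C * ρ
      nlinarith
    · simp only [sub_self, NNReal.coe_zero, sub_zero]
      change 2 * C * ρ * max (b - a) 0 ≤ ρ
      rw [max_eq_left (by linarith)]
      have h1 : (2 * C + 1) * (b - a) ≤ 1 := by
        rw [le_div_iff₀ (by positivity)] at hh
        linarith
      nlinarith
  obtain ⟨x, hxa, hx⟩ := hpl.exists_eq_forall_mem_Icc_hasDerivWithinAt₀
  have hxc : ContinuousOn x (Icc a b) := fun t ht => (hx t ht).continuousWithinAt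
  have hFc := hcont x hxc
  refine ⟨x, hxc, hFc.integrableOn_Icc, fun t ht => ?_⟩
  have hsub' : Icc a t ⊆ Icc a b := Icc_subset_Icc_right ht.2
  have := intervalIntegral.integral_eq_sub_of_hasDerivAt_of_le ht.1 (hxc.mono hsub')
    (fun s hs => (hx s (hsub' (Ioo_subset_Icc_self hs))).hasDerivAt
      (Icc_mem_nhds hs.1 (hs.2.trans_le ht.2)))
    ((hFc.mono (by rw [uIcc_of_le ht.1]; exact hsub')).intervalIntegrable)
  simp only [hF] at this
  rw [this]
  simp only at hxa
  rw [hxa]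
  abel

/-- Two motions may be glued together. -/
theorem IsMotion.glue {Γ : DifferentialGame n P Q} {a b c : ℝ} {x₀ : Vec n}
    {u u' : ℝ → P} {v v' : ℝ → Q} {x x' : ℝ → Vec n} (hab : a ≤ b) (hbc : b ≤ c)
    (h : Γ.IsMotion (Icc a b) a x₀ u v x) (h' : Γ.IsMotion (Icc b c) b (x b) u' v' x') :
    Γ.IsMotion (Icc a c) a x₀ (fun s => if s < b then u s else u' s)
      (fun s => if s < b then v s else v' s) (fun s => if s < b then x s else x' s) := by
  set F : ℝ → Vec n := fun s => Γ.f s (x s) (u s) + Γ.g s (x s) (v s) with hF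
  set F' : ℝ → Vec n := fun s => Γ.f s (x' s) (u' s) + Γ.g s (x' s) (v' s) with hF'
  set G : ℝ → Vec n := fun s => if s < b then F s else F' s with hG
  have hGeq : (fun s => Γ.f s (if s < b then x s else x' s) (if s < b then u s else u' s) +
      Γ.g s (if s < b then x s else x' s) (if s < b then v s else v' s)) = G := by
    funext s
    by_cases hs : s < b <;> simp [hG, hF, hF', hs]
  have hb' : x' b = x b := h'.apply_start ⟨le_rfl, hbc⟩
  have hGF : ∀ s ∈ Ico a b, G s = F s := fun s hs => by simp [hG, hs.2]
  have hGF' : ∀ s, b ≤ s → G s = F' s := fun s hs => by simp [hG, not_lt.2 hs]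
  have hint : IntegrableOn G (Icc a c) := by
    rw [← Ico_union_Icc_eq_Icc hab hbc]
    refine IntegrableOn.union ?_ ?_
    · exact (h.2.1.mono_set Ico_subset_Icc_self).congr_fun
        (fun s hs => (hGF s hs).symm) measurableSet_Ico
    · exact h'.2.1.congr_fun (fun s hs => (hGF' s hs.1).symm) measurableSet_Icc
  have hIF : ∀ t ∈ Icc a b, ∫ s in a..t, G s = ∫ s in a..t, F s := fun t ht => by
    refine intervalIntegral.integral_congr_ae ?_
    have hne : ∀ᵐ s : ℝ, s ≠ b := by simp [ae_iff, measure_singleton]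
    filter_upwards [hne] with s hsb hs
    rw [uIoc_of_le ht.1] at hs
    exact hGF s ⟨hs.1.le, lt_of_le_of_ne (hs.2.trans ht.2) hsb⟩
  have hIF' : ∀ t, b ≤ t → ∫ s in b..t, G s = ∫ s in b..t, F' s := fun t ht => by
    refine intervalIntegral.integral_congr fun s hs => ?_
    rw [uIcc_of_le ht] at hs
    exact hGF' s hs.1
  refine ⟨?_, by rw [hGeq]; exact hint, fun t ht => ?_⟩
  · rw [← Icc_union_Icc_eq_Icc hab hbc]
    refine ContinuousOn.union_of_isClosed ?_ ?_ isClosed_Icc isClosed_Icc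
    · refine h.1.congr fun s hs => ?_
      rcases lt_or_eq_of_le hs.2 with hs' | hs'
      · simp [hs']
      · simp [hs', hb']
    · exact h'.1.congr fun s hs => by simp [not_lt.2 hs.1]
  · rw [hGeq]
    by_cases htb : t < b
    · simp only [htb, if_true]
      rw [hIF t ⟨ht.1, htb.le⟩]
      exact h.2.2 t ⟨ht.1, htb.le⟩
    · have hbt := not_lt.1 htb
      simp only [htb, if_false]
      have hG1 : IntervalIntegrable G volume a b :=
        (hint.mono_set (uIcc_subset_Icc ⟨le_rfl, hab.trans hbc⟩ ⟨hab, hbc⟩)).intervalIntegrable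
      have hG2 : IntervalIntegrable G volume b t :=
        (hint.mono_set (uIcc_subset_Icc ⟨hab, hbc⟩ ht)).intervalIntegrable
      rw [← intervalIntegral.integral_add_adjacent_intervals hG1 hG2, hIF b ⟨hab, le_rfl⟩,
        hIF' t hbt, h'.2.2 t ⟨hbt, ht.2⟩, h.2.2 b ⟨hab, le_rfl⟩, add_assoc]

/-! ### The estimate of extremal aiming over one step -/

/-- Linear growth and the Gronwall inequality confine motions from a ball to a larger ball, where
the velocities are bounded. -/
theorem exists_speed (Γ : DifferentialGame n P Q) (R : ℝ) : ∃ M : ℝ, 0 ≤ M ∧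
    ∃ R', R ≤ R' ∧ ∀ (a b : ℝ) (x₀ : Vec n) (u : ℝ → P) (v : ℝ → Q) (x : ℝ → Vec n),
      0 ≤ a → a ≤ b → b ≤ Γ.T → Γ.IsMotion (Icc a b) a x₀ u v x → ‖x₀‖ ≤ R →
      ∀ t ∈ Icc a b, ‖x t‖ ≤ R' ∧ ‖x t - x₀‖ ≤ M * (t - a) := by
  obtain ⟨C, hC, hgr⟩ := Γ.exists_growth
  rcases lt_or_ge R 0 with hR | hR
  · exact ⟨0, le_rfl, R, le_rfl, fun a b x₀ u v x _ _ _ _ h => absurd h (by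
      have := norm_nonneg x₀; linarith)⟩
  set R' := (1 + R) * Real.exp (C * Γ.T) with hR'
  have hRR' : 1 + R ≤ R' :=
    le_mul_of_one_le_right (by positivity) (Real.one_le_exp (mul_nonneg hC Γ.T_pos.le))
  refine ⟨C * (1 + R'), mul_nonneg hC (by linarith), R', by linarith,
    fun a b x₀ u v x ha hab hb h hx₀ => ?_⟩
  have hbd : ∀ t ∈ Icc a b, ‖x t‖ ≤ R' := fun t ht => by
    have h1 := h.growth ha hab hb hC hgr t ht
    have h2 : (1 + ‖x₀‖) * Real.exp (C * (t - a)) ≤ R' := by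
      rw [hR']
      gcongr
      linarith [ht.2]
    linarith
  refine fun t ht => ⟨hbd t ht, ?_⟩
  rw [h.2.2 t ht, add_sub_cancel_left, ← abs_of_nonneg (sub_nonneg.2 ht.1)]
  refine intervalIntegral.norm_integral_le_of_norm_le_const fun s hs => ?_
  rw [uIoc_of_le ht.1] at hs
  refine (hgr s ⟨ha.trans hs.1.le, (hs.2.trans ht.2).trans hb⟩ _ _ _).trans ?_
  have := hbd s ⟨hs.1.le, hs.2.trans ht.2⟩
  gcongr

/-- The displacement of a motion on a short interval in the direction `p`, estimated by means of
the velocities frozen at the initial time and at a point `ξ`. -/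
theorem exists_inner_le (Γ : DifferentialGame n P Q) [CompactSpace P] [CompactSpace Q] (R : ℝ) :
    ∃ L : ℝ, 0 ≤ L ∧ ∀ ε > 0, ∃ δ > 0, ∀ (a b : ℝ) (x₀ : Vec n) (u : ℝ → P) (v : ℝ → Q)
      (x : ℝ → Vec n), 0 ≤ a → a ≤ b → b ≤ Γ.T → b - a ≤ δ → Γ.IsMotion (Icc a b) a x₀ u v x →
      ‖x₀‖ ≤ R → ∀ ξ : Vec n, ‖ξ‖ ≤ R → ∀ (p : Vec n) (κ : ℝ),
      (∀ s ∈ Ico a b, inner ℝ p (Γ.f a ξ (u s) + Γ.g a ξ (v s)) ≤ κ) →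
      inner ℝ p (x b - x₀) ≤ (b - a) * (κ + ‖p‖ * (L * ‖x₀ - ξ‖ + ε)) := by
  obtain ⟨M, hM, R', hRR', hsp⟩ := Γ.exists_speed R
  obtain ⟨L, hL, hlip⟩ := Γ.exists_lipschitz R'
  refine ⟨L, hL, fun ε hε => ?_⟩
  obtain ⟨δ, hδ, hmod⟩ := Γ.exists_modulus R' (half_pos hε)
  -- Half of `ε` pays for freezing the time; the other half pays for the drift of the state, which
  -- is at most `M * (b - a)` and costs a factor `L`.
  refine ⟨min δ (ε / 2 / (L * M + 1)), lt_min hδ (by positivity),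
    fun a b x₀ u v x ha hab hb hh h hx₀ ξ hξ p κ hκ => ?_⟩
  have hsp := hsp a b x₀ u v x ha hab hb h hx₀
  have hLM : L * M * (b - a) ≤ ε / 2 := by
    have h1 : b - a ≤ ε / 2 / (L * M + 1) := hh.trans (min_le_right _ _)
    rw [le_div_iff₀ (by positivity)] at h1
    nlinarith
  have hii := h.intervalIntegrable (t := b) ⟨hab, le_rfl⟩
  rw [h.2.2 b ⟨hab, le_rfl⟩, add_sub_cancel_left]
  have hip : IntervalIntegrable
      (fun s => inner ℝ p (Γ.f s (x s) (u s) + Γ.g s (x s) (v s))) volume a b :=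
    ⟨hii.1.const_inner p, hii.2.const_inner p⟩
  have hcomm := (innerSL ℝ p).intervalIntegral_comp_comm hii
  simp only [innerSL_apply_apply] at hcomm
  rw [← hcomm]
  have hbound : ∀ s ∈ Ioo a b, inner ℝ p (Γ.f s (x s) (u s) + Γ.g s (x s) (v s)) ≤
      κ + ‖p‖ * (L * ‖x₀ - ξ‖ + ε) := fun s hs => by
    have hs' := Ioo_subset_Icc_self hs
    have hsT : s ∈ Icc 0 Γ.T := ⟨ha.trans hs'.1, hs'.2.trans hb⟩
    have h1 := hlip s hsT (x s) ξ (hsp s hs').1 (hξ.trans hRR') (u s) (v s)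
    have h2 := hmod s hsT a ⟨ha, hab.trans hb⟩ (by
      rw [abs_of_nonneg (by linarith [hs.1])]
      linarith [hs.2, min_le_left δ (ε / 2 / (L * M + 1))]) ξ (hξ.trans hRR') (u s) (v s)
    have h3 : ‖x s - ξ‖ ≤ M * (b - a) + ‖x₀ - ξ‖ := by
      have := norm_sub_le_norm_sub_add_norm_sub (x s) x₀ ξ
      have h5 := (hsp s hs').2
      have : M * (s - a) ≤ M * (b - a) := by gcongr; exact hs'.2
      linarith
    have h4 : ‖(Γ.f s (x s) (u s) + Γ.g s (x s) (v s)) - (Γ.f a ξ (u s) + Γ.g a ξ (v s))‖ ≤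
        L * ‖x₀ - ξ‖ + ε := by
      refine (norm_sub_le_norm_sub_add_norm_sub _ (Γ.f s ξ (u s) + Γ.g s ξ (v s)) _).trans ?_
      have := mul_le_mul_of_nonneg_left h3 hL
      linarith
    have h5 := (real_inner_le_norm p ((Γ.f s (x s) (u s) + Γ.g s (x s) (v s)) -
      (Γ.f a ξ (u s) + Γ.g a ξ (v s)))).trans (mul_le_mul_of_nonneg_left h4 (norm_nonneg p))
    rw [inner_sub_right] at h5
    linarith [hκ s ⟨hs.1.le, hs.2⟩]
  refine (intervalIntegral.integral_mono_on_of_le_Ioo hab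
    hip intervalIntegrable_const hbound).trans ?_
  rw [intervalIntegral.integral_const, smul_eq_mul]

/-- On the interval `[a,b]` the system goes from `ξ` to `ξ'` while the model goes from `η` to `η'`,
and the frozen velocities of the two are separated in the direction `ξ - η`, that of the system
being the one that brings them together. -/
def AimStep (Γ : DifferentialGame n P Q) (a b : ℝ) (ξ η ξ' η' : Vec n) : Prop :=
  ∃ κ : ℝ,
    (∃ (u : ℝ → P) (v : ℝ → Q) (x : ℝ → Vec n), Γ.IsMotion (Icc a b) a ξ u v x ∧ x b = ξ' ∧
      ∀ s ∈ Ico a b, inner ℝ (ξ - η) (Γ.f a ξ (u s) + Γ.g a ξ (v s)) ≤ κ) ∧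
    (η, η') ∈ closure {q : Vec n × Vec n | ∃ (u : ℝ → P) (v : ℝ → Q) (z : ℝ → Vec n),
      Γ.IsMotion (Icc a b) a q.1 u v z ∧ z b = q.2 ∧
      ∀ s ∈ Ico a b, κ ≤ inner ℝ (ξ - η) (Γ.f a ξ (u s) + Γ.g a ξ (v s))}

/-- Expand the square of the new distance. In the inner product of `ξ - η` with the difference of
the displacements the two occurrences of `κ` cancel, leaving a Lipschitz term proportional to `‖ξ -
η‖ ^ 2` and small errors; the square of that difference is of second order in the length of the
step. -/
theorem exists_aimStep_bound (Γ : DifferentialGame n P Q) [CompactSpace P] [CompactSpace Q]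
    (R : ℝ) : ∃ K : ℝ, 0 ≤ K ∧ ∀ ε > 0, ∃ δ > 0, ∀ (a b : ℝ) (ξ η ξ' η' : Vec n),
      0 ≤ a → a ≤ b → b ≤ Γ.T → b - a ≤ δ → ‖ξ‖ ≤ R → ‖η‖ ≤ R → Γ.AimStep a b ξ η ξ' η' →
      ‖ξ' - η'‖ ^ 2 ≤ (1 + K * (b - a)) * ‖ξ - η‖ ^ 2 + ε * (b - a) := by
  -- The motions approximating the model start only near `η`, hence the radius `R + 1` instead of
  -- `R`.
  obtain ⟨M, hM, R', -, hsp⟩ := Γ.exists_speed (R + 1)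
  obtain ⟨L, hL, hin⟩ := Γ.exists_inner_le (R + 1)
  refine ⟨2 * L, by positivity, fun ε hε => ?_⟩
  rcases lt_or_ge R 0 with hR | hR
  · exact ⟨1, one_pos, fun a b ξ η ξ' η' _ _ _ _ h => absurd h (by
      have := norm_nonneg ξ; linarith)⟩
  obtain ⟨δ, hδ, hin⟩ := hin (ε / (16 * R + 1)) (by positivity)
  refine ⟨min δ (ε / 2 / (4 * M ^ 2 + 1)), lt_min hδ (by positivity),
    fun a b ξ η ξ' η' ha hab hb hh hξ hη ⟨κ, ⟨u, v, x, hx, hxb, hκ⟩, hcl⟩ => ?_⟩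
  set h := b - a with hh_def
  have h0 : 0 ≤ h := sub_nonneg.2 hab
  have hhδ : h ≤ δ := hh.trans (min_le_left _ _)
  have hhM : 4 * M ^ 2 * h ≤ ε / 2 := by
    have h1 := hh.trans (min_le_right _ _)
    rw [le_div_iff₀ (by positivity)] at h1
    nlinarith
  set ε' := ε / (16 * R + 1) with hε'
  have hε'R : 16 * R * ε' ≤ ε := by
    have : (16 * R + 1) * ε' = ε := by rw [hε']; field_simp
    have : 0 < ε' := by positivity
    nlinarith
  set e := ξ - η with he
  have hx1 := hin a b ξ u v x ha hab hb hhδ hx (by linarith) ξ (by linarith) e κ hκ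
  have hx2 := (hsp a b ξ u v x ha hab hb hx (by linarith) b ⟨hab, le_rfl⟩).2
  rw [hxb] at hx1 hx2
  rw [sub_self, norm_zero, mul_zero, zero_add] at hx1
  obtain ⟨q, hq, hqlim⟩ := mem_closure_iff_seq_limit.1 hcl
  have hq1 : Tendsto (fun i => (q i).1) atTop (𝓝 η) :=
    (continuous_fst.tendsto _).comp hqlim
  have hq2 : Tendsto (fun i => (q i).2) atTop (𝓝 η') :=
    (continuous_snd.tendsto _).comp hqlim
  have hev : ∀ᶠ i in atTop, ‖(q i).1‖ < R + 1 :=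
    hq1.norm.eventually_lt_const (by linarith)
  -- The lower bound on the model velocities is an upper bound in the direction `-e`; the estimate
  -- is obtained for the approximating motions and passes to the limit.
  have hz1 : inner ℝ (-e) (η' - η) ≤ h * (-κ + ‖-e‖ * (L * ‖η - ξ‖ + ε')) := by
    refine le_of_tendsto_of_tendsto (tendsto_const_nhds.inner (hq2.sub hq1))
      ((((((hq1.sub_const ξ).norm).const_mul L).add_const ε').const_mul ‖-e‖).const_add
        (-κ) |>.const_mul h) ?_
    filter_upwards [hev] with i hi
    obtain ⟨u', v', z, hz, hzb, hκ'⟩ := hq i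
    have := hin a b (q i).1 u' v' z ha hab hb hhδ hz hi.le ξ (by linarith) (-e) (-κ)
      (fun s hs => by rw [inner_neg_left]; linarith [hκ' s hs])
    rwa [hzb] at this
  have hz2 : ‖η' - η‖ ≤ M * h := by
    refine le_of_tendsto (hq2.sub hq1).norm ?_
    filter_upwards [hev] with i hi
    obtain ⟨u', v', z, hz, hzb, -⟩ := hq i
    have := (hsp a b (q i).1 u' v' z ha hab hb hz hi.le b ⟨hab, le_rfl⟩).2
    rwa [hzb] at this
  have hne : ‖η - ξ‖ = ‖e‖ := norm_sub_rev _ _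
  have heR : ‖e‖ ≤ 2 * R := (norm_sub_le _ _).trans (by linarith)
  have hdecomp : ξ' - η' = e + ((ξ' - ξ) - (η' - η)) := by rw [he]; abel
  have hD : ‖(ξ' - ξ) - (η' - η)‖ ≤ 2 * M * h := (norm_sub_le _ _).trans (by linarith)
  have hD2 : ‖(ξ' - ξ) - (η' - η)‖ ^ 2 ≤ (2 * M * h) ^ 2 :=
    pow_le_pow_left₀ (norm_nonneg _) hD 2
  rw [hdecomp, norm_add_sq_real, inner_sub_right]
  rw [inner_neg_left, norm_neg, hne] at hz1
  have h1 : ‖e‖ * ε' ≤ 2 * R * ε' := mul_le_mul_of_nonneg_right heR (by positivity)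
  have h2 : h * (‖e‖ * ε') ≤ h * (ε / 8) := mul_le_mul_of_nonneg_left (by linarith) h0
  have h3 : h * (4 * M ^ 2 * h) ≤ h * (ε / 2) := mul_le_mul_of_nonneg_left hhM h0
  nlinarith

end DifferentialGame

/-! ### Guides with states in a finite-dimensional space -/

namespace GuideStrategy

variable {n : ℕ} {A S : Type*} [NormedAddCommGroup S] [NormedSpace ℝ S] [FiniteDimensional ℝ S]

/-- The control-with-guide strategy whose guide takes its states in a finite-dimensional space,
identified with some `ℝᵐ`. -/
noncomputable def ofState (control : ℝ → Vec n → S → A) (transition : ℝ → ℝ → Vec n → S → S)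
    (initial : ℝ → Vec n → S) : GuideStrategy n A where
  m := Module.finrank ℝ S
  control t x w := control t x (toEuclidean.symm w)
  transition t' t x w := toEuclidean (transition t' t x (toEuclidean.symm w))
  initial t x := toEuclidean (initial t x)

/-- The states of the guide before the identification with `ℝᵐ`. -/
def states (transition : ℝ → ℝ → Vec n → S → S) (initial : ℝ → Vec n → S) (t : ℕ → ℝ)
    (x : ℝ → Vec n) : ℕ → S
  | 0 => initial (t 0) (x (t 0))
  | k + 1 => transition (t (k + 1)) (t k) (x (t k)) (states transition initial t x k)

theorem guide_ofState (control : ℝ → Vec n → S → A) (transition : ℝ → ℝ → Vec n → S → S)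
    (initial : ℝ → Vec n → S) (t : ℕ → ℝ) (x : ℝ → Vec n) (k : ℕ) :
    (ofState control transition initial).guide t x k =
      toEuclidean (states transition initial t x k) := by
  induction k with
  | zero => rfl
  | succ k ih =>
    change toEuclidean (transition _ _ _ (toEuclidean.symm _)) = _
    rw [ih, ContinuousLinearEquiv.symm_apply_apply]
    rfl

theorem forms_ofState_iff {control : ℝ → Vec n → S → A} {transition : ℝ → ℝ → Vec n → S → S}
    {initial : ℝ → Vec n → S} {a b : ℝ} {Δ : TimePartition a b} {x : ℝ → Vec n} {u : ℝ → A} :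
    (ofState control transition initial).Forms Δ x u ↔
      ∀ k < Δ.r, ∀ s ∈ Ico (Δ.t k) (Δ.t (k + 1)),
        u s = control (Δ.t k) (x (Δ.t k)) (states transition initial Δ.t x k) := by
  simp only [Forms, guide_ofState]
  simp only [ofState, ContinuousLinearEquiv.symm_apply_apply]

end GuideStrategy

/-! ### Partitions -/

namespace TimePartition

variable {a b : ℝ} (Δ : TimePartition a b)

theorem t_mono {j k : ℕ} (hjk : j ≤ k) (hk : k ≤ Δ.r) : Δ.t j ≤ Δ.t k := by
  induction k, hjk using Nat.le_induction with
  | base => exact le_rfl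
  | succ k _ ih => exact (ih (by omega)).trans (Δ.t_lt k (by omega)).le

theorem left_le {k : ℕ} (hk : k ≤ Δ.r) : a ≤ Δ.t k :=
  Δ.t_zero.symm.le.trans (Δ.t_mono (Nat.zero_le k) hk)

theorem le_right {k : ℕ} (hk : k ≤ Δ.r) : Δ.t k ≤ b :=
  (Δ.t_mono hk le_rfl).trans Δ.t_last.le

theorem step_le_mesh {k : ℕ} (hk : k < Δ.r) : Δ.t (k + 1) - Δ.t k ≤ Δ.mesh :=
  le_ciSup (f := fun k : Fin Δ.r => Δ.t ((k : ℕ) + 1) - Δ.t (k : ℕ))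
    (Set.finite_range _).bddAbove ⟨k, hk⟩

/-- There are partitions of arbitrarily small fineness. -/
theorem exists_mesh_le (hab : a ≤ b) {δ : ℝ} (hδ : 0 < δ) :
    ∃ Δ : TimePartition a b, Δ.mesh ≤ δ := by
  rcases hab.eq_or_lt with rfl | hlt
  -- At `a = b` there are no steps, and the supremum over the empty family of steps is zero.
  · exact ⟨⟨0, fun _ => a, rfl, rfl, by simp⟩, Real.iSup_le (fun k => k.elim0) hδ.le⟩
  · obtain ⟨N, hN⟩ := exists_nat_ge ((b - a) / δ)
    have hN' : (b - a) / δ ≤ (N : ℝ) + 1 := hN.trans (by linarith)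
    have hpos : (0 : ℝ) < (N : ℝ) + 1 := by positivity
    have hstep : ∀ k : ℕ, (a + ((k + 1 : ℕ) : ℝ) * ((b - a) / (N + 1))) -
        (a + (k : ℝ) * ((b - a) / (N + 1))) = (b - a) / (N + 1) := fun k => by
      push_cast; ring
    refine ⟨⟨N + 1, fun k => a + k * ((b - a) / (N + 1)), by simp, ?_, fun k _ => ?_⟩, ?_⟩
    · push_cast
      field_simp
      ring
    · have h1 : 0 < (b - a) / (N + 1) := div_pos (sub_pos.2 hlt) hpos
      linarith [hstep k]
    · refine Real.iSup_le (fun k => ?_) hδ.le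
      change (a + (((k : ℕ) + 1 : ℕ) : ℝ) * ((b - a) / (N + 1))) -
        (a + ((k : ℕ) : ℝ) * ((b - a) / (N + 1))) ≤ δ
      rw [hstep, div_le_iff₀ hpos]
      rw [div_le_iff₀ hδ] at hN'
      linarith

end TimePartition

/-! ### Aiming, predictions and the steps of the model -/

namespace DifferentialGame

variable {n : ℕ} {P Q : Type*} [MetricSpace P] [MetricSpace Q]

/-- A control of player I whose contribution to the velocity in the direction `p` is the
smallest. -/
noncomputable def aimControl (Γ : DifferentialGame n P Q) [Nonempty P] (t : ℝ) (x p : Vec n) : P :=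
  Classical.epsilon fun u => ∀ u', (inner ℝ p (Γ.f t x u) : ℝ) ≤ inner ℝ p (Γ.f t x u')

theorem inner_aimControl_le (Γ : DifferentialGame n P Q) [Nonempty P] [CompactSpace P] {t : ℝ}
    (ht : t ∈ Icc 0 Γ.T) (x p : Vec n) (u : P) :
    (inner ℝ p (Γ.f t x (Γ.aimControl t x p)) : ℝ) ≤ inner ℝ p (Γ.f t x u) := by
  have hc : Continuous fun u => Γ.f t x u :=
    Γ.continuousOn_f.comp_continuous (f := fun u : P => (t, x, u)) (by fun_prop)
      fun u => ⟨ht, mem_univ _⟩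
  obtain ⟨u₀, -, hu₀⟩ := isCompact_univ.exists_isMinOn univ_nonempty
    (f := fun u => (inner ℝ p (Γ.f t x u) : ℝ)) (continuous_const.inner hc).continuousOn
  exact Classical.epsilon_spec
    (p := fun u => ∀ u', (inner ℝ p (Γ.f t x u) : ℝ) ≤ inner ℝ p (Γ.f t x u'))
    ⟨u₀, fun u' => hu₀ (mem_univ u')⟩ u

/-- The state at the time `t'` if from the state `x` at the time `t` on both players aim at `w`. -/
noncomputable def prediction (Γ : DifferentialGame n P Q) [Nonempty P] [Nonempty Q] (t : ℝ)
    (x w : Vec n) (t' : ℝ) : Vec n :=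
  Classical.epsilon fun ξ => ∃ z : ℝ → Vec n, Γ.IsMotion (Icc t t') t x
    (fun _ => Γ.aimControl t x (x - w)) (fun _ => Γ.swap.aimControl t x (x - w)) z ∧ z t' = ξ

/-- Both players predict the same state, so on a joint motion their guides agree about the absence
of deviations. -/
theorem prediction_swap (Γ : DifferentialGame n P Q) [Nonempty P] [Nonempty Q] :
    Γ.swap.prediction = Γ.prediction := by
  unfold prediction
  simp only [isMotion_swap]
  rfl

theorem exists_motion_prediction (Γ : DifferentialGame n P Q) [Nonempty P] [Nonempty Q] :
    ∃ h > 0, ∀ t t' : ℝ, 0 ≤ t → t ≤ t' → t' ≤ Γ.T → t' - t ≤ h → ∀ x w : Vec n,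
      ∃ z : ℝ → Vec n, Γ.IsMotion (Icc t t') t x (fun _ => Γ.aimControl t x (x - w))
        (fun _ => Γ.swap.aimControl t x (x - w)) z ∧ z t' = Γ.prediction t x w t' := by
  obtain ⟨h, hh, H⟩ := Γ.exists_isMotion_const
  refine ⟨h, hh, fun t t' ht htt' ht' hst x w => ?_⟩
  obtain ⟨z, hz⟩ := H t t' ht htt' ht' hst x (Γ.aimControl t x (x - w))
    (Γ.swap.aimControl t x (x - w))
  exact Classical.epsilon_spec (p := fun ξ => ∃ z : ℝ → Vec n, Γ.IsMotion (Icc t t') t x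
    (fun _ => Γ.aimControl t x (x - w)) (fun _ => Γ.swap.aimControl t x (x - w)) z ∧ z t' = ξ)
    ⟨_, z, hz, rfl⟩

/-- Uniqueness of motions turns the prediction into an equality, which is why the test for a
deviation may be an exact comparison of states. -/
theorem IsMotion.eq_prediction {Γ : DifferentialGame n P Q} [Nonempty P] [Nonempty Q] {t t' : ℝ}
    {ξ w : Vec n} {u : ℝ → P} {v : ℝ → Q} {x : ℝ → Vec n}
    (h : Γ.IsMotion (Icc t t') t ξ u v x) (ht : 0 ≤ t) (htt' : t ≤ t') (ht' : t' ≤ Γ.T)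
    (hu : ∀ s ∈ Ico t t', u s = Γ.aimControl t ξ (ξ - w))
    (hv : ∀ s ∈ Ico t t', v s = Γ.swap.aimControl t ξ (ξ - w)) :
    x t' = Γ.prediction t ξ w t' := by
  have h' : Γ.IsMotion (Icc t t') t ξ (fun _ => Γ.aimControl t ξ (ξ - w))
      (fun _ => Γ.swap.aimControl t ξ (ξ - w)) x := by
    have hF : ∀ s, s ≠ t' → s ∈ Icc t t' → Γ.f s (x s) (u s) + Γ.g s (x s) (v s) =
        Γ.f s (x s) (Γ.aimControl t ξ (ξ - w)) +
          Γ.g s (x s) (Γ.swap.aimControl t ξ (ξ - w)) := fun s hs hs' => by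
      have hs'' : s ∈ Ico t t' := ⟨hs'.1, lt_of_le_of_ne hs'.2 hs⟩
      rw [hu s hs'', hv s hs'']
    have hne : ∀ᵐ s : ℝ, s ≠ t' := by simp [ae_iff, measure_singleton]
    refine ⟨h.1, h.2.1.congr_fun_ae ?_, fun r hr => ?_⟩
    · rw [EventuallyEq, ae_restrict_iff' measurableSet_Icc]
      filter_upwards [hne] with s hs hs' using hF s hs hs'
    · rw [h.2.2 r hr]
      congr 1
      refine intervalIntegral.integral_congr_ae ?_
      filter_upwards [hne] with s hs hs'
      rw [uIoc_of_le hr.1] at hs'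
      exact hF s hs ⟨hs'.1.le, hs'.2.trans hr.2⟩
  obtain ⟨z, hz, hzt⟩ := Classical.epsilon_spec (p := fun ζ => ∃ z : ℝ → Vec n,
    Γ.IsMotion (Icc t t') t ξ (fun _ => Γ.aimControl t ξ (ξ - w))
      (fun _ => Γ.swap.aimControl t ξ (ξ - w)) z ∧ z t' = ζ) ⟨_, x, h', rfl⟩
  refine (h'.unique hz ht htt' ht' (fun _ _ => rfl) (fun _ _ => rfl) t' ⟨htt', le_rfl⟩).trans hzt

/-- The pairs of end points of the motions on `[a,b]` under controls with values in `A`. -/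
def arcs (Γ : DifferentialGame n P Q) (A : Set (P × Q)) (a b : ℝ) : Set (Vec n × Vec n) :=
  {q | ∃ (u : ℝ → P) (v : ℝ → Q) (z : ℝ → Vec n),
    Γ.IsMotion (Icc a b) a q.1 u v z ∧ z b = q.2 ∧ ∀ s, (u s, v s) ∈ A}

theorem growth_of_mem_closure_arcs {Γ : DifferentialGame n P Q} {A : Set (P × Q)} {a b C : ℝ}
    {q : Vec n × Vec n} (hq : q ∈ closure (Γ.arcs A a b)) (ha : 0 ≤ a) (hab : a ≤ b)
    (hb : b ≤ Γ.T) (hC : 0 ≤ C) (hgr : ∀ t ∈ Icc 0 Γ.T, ∀ (x : Vec n) (u : P) (v : Q),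
      ‖Γ.f t x u + Γ.g t x v‖ ≤ C * (1 + ‖x‖)) :
    1 + ‖q.2‖ ≤ (1 + ‖q.1‖) * Real.exp (C * (b - a)) := by
  refine closure_minimal (t := {q : Vec n × Vec n |
    1 + ‖q.2‖ ≤ (1 + ‖q.1‖) * Real.exp (C * (b - a))}) ?_
    (isClosed_le (by fun_prop) (by fun_prop)) hq
  rintro q ⟨u, v, z, hz, hzb, -⟩
  have := hz.growth ha hab hb hC hgr b ⟨hab, le_rfl⟩
  rwa [hzb] at this

/-- Evaluation at two times is continuous for the uniform norm, so it carries limits of motions to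
limits of pairs of end points. The approximating motions need not pass through `y a`, and this is
why the initial point varies in `arcs`. -/
theorem mem_closure_arcs_of_mem_sol {Γ : DifferentialGame n P Q} [MeasurableSpace P]
    [MeasurableSpace Q] {t₀ : ℝ} {x₀ : Vec n} {y : C(Icc (0 : ℝ) Γ.T, Vec n)}
    (hy : y ∈ Γ.sol t₀ x₀) (ht₀ : t₀ ∈ Icc 0 Γ.T) {a b : Icc (0 : ℝ) Γ.T} (hab : a ≤ b) :
    (y a, y b) ∈ closure (Γ.arcs univ a b) := by
  refine map_mem_closure (f := fun y : C(Icc (0 : ℝ) Γ.T, Vec n) => (y a, y b))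
    (by fun_prop) hy ?_
  rintro y ⟨u, v, x, -, -, hx, hyx⟩
  refine ⟨u, v, x, ?_, (hyx b).symm, fun _ => mem_univ _⟩
  change Γ.IsMotion _ _ (y a) _ _ _
  rw [hyx a]
  exact hx.restrict ht₀ a.2.1 hab b.2.2

theorem mem_closure_arcs_of_mem_sol₁ {Γ : DifferentialGame n P Q} [MeasurableSpace P] {t₀ : ℝ}
    {x₀ : Vec n} {v₀ : Q} {y : C(Icc (0 : ℝ) Γ.T, Vec n)} (hy : y ∈ Γ.sol₁ t₀ x₀ v₀)
    (ht₀ : t₀ ∈ Icc 0 Γ.T) {a b : Icc (0 : ℝ) Γ.T} (hab : a ≤ b) :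
    (y a, y b) ∈ closure (Γ.arcs {q | q.2 = v₀} a b) := by
  refine map_mem_closure (f := fun y : C(Icc (0 : ℝ) Γ.T, Vec n) => (y a, y b))
    (by fun_prop) hy ?_
  rintro y ⟨u, x, -, hx, hyx⟩
  refine ⟨u, fun _ => v₀, x, ?_, (hyx b).symm, fun _ => rfl⟩
  change Γ.IsMotion _ _ (y a) _ _ _
  rw [hyx a]
  exact hx.restrict ht₀ a.2.1 hab b.2.2

theorem apply_of_mem_sol {Γ : DifferentialGame n P Q} [MeasurableSpace P]
    [MeasurableSpace Q] {t₀ : ℝ} {x₀ : Vec n} {y : C(Icc (0 : ℝ) Γ.T, Vec n)}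
    (hy : y ∈ Γ.sol t₀ x₀) (ht₀ : t₀ ∈ Icc 0 Γ.T) : y ⟨t₀, ht₀⟩ = x₀ := by
  refine closure_minimal (t := {y : C(Icc (0 : ℝ) Γ.T, Vec n) | y ⟨t₀, ht₀⟩ = x₀}) ?_
    (isClosed_eq (by fun_prop) continuous_const) hy
  rintro y ⟨u, v, x, -, -, hx, hyx⟩
  exact (hyx ⟨t₀, ht₀⟩).trans (hx.apply_start ht₀)

theorem apply_of_mem_sol₁ {Γ : DifferentialGame n P Q} [MeasurableSpace P] {t₀ : ℝ}
    {x₀ : Vec n} {v₀ : Q} {y : C(Icc (0 : ℝ) Γ.T, Vec n)} (hy : y ∈ Γ.sol₁ t₀ x₀ v₀)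
    (ht₀ : t₀ ∈ Icc 0 Γ.T) : y ⟨t₀, ht₀⟩ = x₀ := by
  refine closure_minimal (t := {y : C(Icc (0 : ℝ) Γ.T, Vec n) | y ⟨t₀, ht₀⟩ = x₀}) ?_
    (isClosed_eq (by fun_prop) continuous_const) hy
  rintro y ⟨u, x, -, hx, hyx⟩
  exact (hyx ⟨t₀, ht₀⟩).trans (hx.apply_start ht₀)

/-- The two players together bring the system closer to any motion of the model. -/
theorem aimStep_prediction (Γ : DifferentialGame n P Q) [Nonempty P] [Nonempty Q]
    [CompactSpace P] [CompactSpace Q] {a b : ℝ} {ξ η η' : Vec n} (ha : a ∈ Icc 0 Γ.T)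
    (hz : ∃ z : ℝ → Vec n, Γ.IsMotion (Icc a b) a ξ (fun _ => Γ.aimControl a ξ (ξ - η))
        (fun _ => Γ.swap.aimControl a ξ (ξ - η)) z ∧ z b = Γ.prediction a ξ η b)
    (hη : (η, η') ∈ closure (Γ.arcs univ a b)) :
    Γ.AimStep a b ξ η (Γ.prediction a ξ η b) η' := by
  obtain ⟨z, hz, hzb⟩ := hz
  refine ⟨_, ⟨_, _, z, hz, hzb, fun s _ => le_rfl⟩, closure_mono ?_ hη⟩
  rintro q ⟨u, v, z, hz, hzb, -⟩
  refine ⟨u, v, z, hz, hzb, fun s _ => ?_⟩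
  rw [inner_add_right, inner_add_right]
  exact add_le_add (Γ.inner_aimControl_le ha _ _ _) (Γ.swap.inner_aimControl_le ha _ _ _)

/-- Player I alone brings the system closer to the model in which player II uses a control that
is the worst one for the approach. -/
theorem aimStep_of_mem_arcs {Γ : DifferentialGame n P Q} [Nonempty P] [Nonempty Q]
    [CompactSpace P] [CompactSpace Q] {a b : ℝ} {ξ η η' : Vec n} {u : ℝ → P} {v : ℝ → Q}
    {x : ℝ → Vec n} (ha : a ∈ Icc 0 Γ.T) (hx : Γ.IsMotion (Icc a b) a ξ u v x)
    (hu : ∀ s ∈ Ico a b, u s = Γ.aimControl a ξ (ξ - η))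
    (hη : (η, η') ∈ closure (Γ.arcs {q | q.2 = Γ.swap.aimControl a ξ (η - ξ)} a b)) :
    Γ.AimStep a b ξ η (x b) η' := by
  refine ⟨inner ℝ (ξ - η) (Γ.f a ξ (Γ.aimControl a ξ (ξ - η)) +
    Γ.g a ξ (Γ.swap.aimControl a ξ (η - ξ))), ⟨u, v, x, hx, rfl, fun s hs => ?_⟩,
    closure_mono ?_ hη⟩
  · have := Γ.swap.inner_aimControl_le ha ξ (η - ξ) (v s)
    rw [← neg_sub ξ η, inner_neg_left, inner_neg_left, neg_le_neg_iff] at this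
    rw [hu s hs, inner_add_right, inner_add_right, ← neg_sub ξ η]
    exact add_le_add le_rfl this
  · rintro q ⟨u', v', z, hz, hzb, hA⟩
    refine ⟨u', v', z, hz, hzb, fun s _ => ?_⟩
    have hv' : v' s = Γ.swap.aimControl a ξ (η - ξ) := hA s
    rw [inner_add_right, inner_add_right, hv']
    exact add_le_add (Γ.inner_aimControl_le ha _ _ _) le_rfl

/-- The condition on `y` that is used to choose the motion of the model for player I. -/
def IsPunishment (Γ : DifferentialGame n P Q) [MeasurableSpace P] (c : ℝ → Vec n → ℝ) (t : ℝ)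
    (w : Vec n) (v : Q) (y : C(Icc (0 : ℝ) Γ.T, Vec n)) : Prop :=
  y ∈ Γ.sol₁ t w v ∧ ∀ s : Icc (0 : ℝ) Γ.T, t ≤ s → c s (y s) ≤ c t w

/-- The next state of the model of player I, who keeps the function `c` from growing. -/
noncomputable def punishment (Γ : DifferentialGame n P Q) [MeasurableSpace P] [Nonempty Q]
    (c : ℝ → Vec n → ℝ) (t : ℝ) (x w : Vec n) (t' : ℝ) : Vec n :=
  Classical.epsilon (Γ.IsPunishment c t w (Γ.swap.aimControl t x (w - x)))
    (projIcc 0 Γ.T Γ.T_pos.le t')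

/-- The control of player II that is worst for the approach is fixed by the states at time `a`, so
(F3) applies to it as a constant control. -/
theorem punishment_spec {Γ : DifferentialGame n P Q} [MeasurableSpace P] [Nonempty Q]
    {c : ℝ → Vec n → ℝ}
    (hc : ∀ t ∈ Icc 0 Γ.T, ∀ (w : Vec n) (v : Q), ∃ y ∈ Γ.sol₁ t w v,
      ∀ s : Icc (0 : ℝ) Γ.T, t ≤ s → c s (y s) ≤ c t w)
    {a b : ℝ} (ha : 0 ≤ a) (hab : a ≤ b) (hb : b ≤ Γ.T) (x w : Vec n) :
    c b (Γ.punishment c a x w b) ≤ c a w ∧ (w, Γ.punishment c a x w b) ∈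
      closure (Γ.arcs {q | q.2 = Γ.swap.aimControl a x (w - x)} a b) := by
  have haT : a ∈ Icc 0 Γ.T := ⟨ha, hab.trans hb⟩
  have hbT : b ∈ Icc 0 Γ.T := ⟨ha.trans hab, hb⟩
  obtain ⟨hy, hyc⟩ := Classical.epsilon_spec
    (p := Γ.IsPunishment c a w (Γ.swap.aimControl a x (w - x))) (hc a haT w _)
  unfold punishment
  set y := Classical.epsilon (Γ.IsPunishment c a w (Γ.swap.aimControl a x (w - x)))
  rw [projIcc_of_mem _ hbT]
  refine ⟨hyc ⟨b, hbT⟩ hab, ?_⟩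
  have := mem_closure_arcs_of_mem_sol₁ hy haT (a := ⟨a, haT⟩) (b := ⟨b, hbT⟩) hab
  rwa [apply_of_mem_sol₁ hy haT] at this

/-- Stepwise feedback controls generate a motion for every fine partition. -/
theorem exists_stepwise (Γ : DifferentialGame n P Q) [Nonempty P] [Nonempty Q] : ∃ h > 0,
    ∀ (t₀ : ℝ) (x₀ : Vec n) (Δ : TimePartition t₀ Γ.T) (α : ℝ → Vec n → P) (β : ℝ → Vec n → Q),
      0 ≤ t₀ → Δ.mesh ≤ h → ∃ (u : ℝ → P) (v : ℝ → Q) (x : ℝ → Vec n),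
        Γ.IsMotion (Icc t₀ Γ.T) t₀ x₀ u v x ∧ ∀ j < Δ.r, ∀ s ∈ Ico (Δ.t j) (Δ.t (j + 1)),
          u s = α (Δ.t j) (x (Δ.t j)) ∧ v s = β (Δ.t j) (x (Δ.t j)) := by
  obtain ⟨h, hh, H⟩ := Γ.exists_isMotion_const
  refine ⟨h, hh, fun t₀ x₀ Δ α β ht₀ hmesh => ?_⟩
  suffices hk : ∀ k ≤ Δ.r, ∃ (u : ℝ → P) (v : ℝ → Q) (x : ℝ → Vec n),
      Γ.IsMotion (Icc t₀ (Δ.t k)) t₀ x₀ u v x ∧ ∀ j < k, ∀ s ∈ Ico (Δ.t j) (Δ.t (j + 1)),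
        u s = α (Δ.t j) (x (Δ.t j)) ∧ v s = β (Δ.t j) (x (Δ.t j)) by
    have := hk Δ.r le_rfl
    rwa [Δ.t_last] at this
  intro k
  induction k with
  | zero =>
    refine fun _ => ⟨fun _ => Classical.arbitrary P, fun _ => Classical.arbitrary Q,
      fun _ => x₀, ⟨continuousOn_const, ?_, fun t ht => ?_⟩, fun j hj => absurd hj (by omega)⟩
    · rw [Δ.t_zero, Icc_self]
      exact integrableOn_singleton (hx := by simp)
    · rw [Δ.t_zero, Icc_self, mem_singleton_iff] at ht
      simp [ht]
  | succ k ih =>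
    intro hk
    obtain ⟨u, v, x, hx, hform⟩ := ih (by omega)
    have hkk : Δ.t k ≤ Δ.t (k + 1) := (Δ.t_lt k hk).le
    have h0k := Δ.left_le (k := k) (by omega)
    obtain ⟨z, hz⟩ := H (Δ.t k) (Δ.t (k + 1)) (ht₀.trans h0k) hkk
      (Δ.le_right hk) ((Δ.step_le_mesh hk).trans hmesh) (x (Δ.t k)) (α (Δ.t k) (x (Δ.t k)))
      (β (Δ.t k) (x (Δ.t k)))
    -- The controls on the new step depend only on the state at its left end, which is already
    -- known.
    refine ⟨_, _, _, hx.glue h0k hkk hz, fun j hj s hs => ?_⟩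
    rcases Nat.lt_succ_iff_lt_or_eq.1 hj with hj | rfl
    · have h1 : Δ.t (j + 1) ≤ Δ.t k := Δ.t_mono hj (by omega)
      have h2 : s < Δ.t k := hs.2.trans_le h1
      have h3 : Δ.t j < Δ.t k := (Δ.t_lt j (by omega)).trans_le h1
      simp only [h2, h3, if_true]
      exact hform j hj s hs
    · have h2 : ¬ s < Δ.t j := not_lt.2 hs.1
      simp only [h2, lt_irrefl, if_false, hz.apply_start ⟨le_rfl, hkk⟩, and_self]

/-- The tolerance `E` within which the system follows the model on fine partitions. -/
theorem exists_tolerance (Γ : DifferentialGame n P Q) [CompactSpace P] [CompactSpace Q]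
    (R : ℝ) {t₀ : ℝ} (ht₀ : 0 ≤ t₀) {θ : ℝ} (hθ : 0 < θ) : ∃ E : ℝ → ℝ, ∃ δ > 0,
      (∀ t ∈ Icc t₀ Γ.T, 0 ≤ E t ∧ E t ≤ θ ^ 2) ∧
      ∀ (a b : ℝ) (ξ η ξ' η' : Vec n), t₀ ≤ a → a ≤ b → b ≤ Γ.T → b - a ≤ δ →
        ‖ξ‖ ≤ R → ‖η‖ ≤ R → Γ.AimStep a b ξ η ξ' η' → ‖ξ - η‖ ^ 2 ≤ E a →
        ‖ξ' - η'‖ ^ 2 ≤ E b := by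
  obtain ⟨K, hK, hstep⟩ := Γ.exists_aimStep_bound R
  have hT := Γ.T_pos
  set ε := θ ^ 2 / (Real.exp (K * Γ.T) * Γ.T) with hε
  have hε0 : 0 < ε := by positivity
  obtain ⟨δ, hδ, hstep⟩ := hstep ε hε0
  -- This function dominates the recursion of one step, because `1 + K * h ≤ exp (K * h)`; `ε` was
  -- chosen so that it stays below `θ ^ 2` up to the time `T`.
  refine ⟨fun t => Real.exp (K * (t - t₀)) * ε * (t - t₀), δ, hδ, fun t ht => ⟨?_, ?_⟩,
    fun a b ξ η ξ' η' ha hab hb hh hξ hη h hE => ?_⟩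
  · have := sub_nonneg.2 ht.1
    positivity
  · have h1 := sub_nonneg.2 ht.1
    have h2 : t - t₀ ≤ Γ.T := by linarith [ht.2]
    calc Real.exp (K * (t - t₀)) * ε * (t - t₀) ≤ Real.exp (K * Γ.T) * ε * Γ.T := by gcongr
      _ = θ ^ 2 := by rw [hε]; field_simp
  · refine (hstep a b ξ η ξ' η' (ht₀.trans ha) hab hb hh hξ hη h).trans ?_
    have h1 : 0 ≤ b - a := sub_nonneg.2 hab
    have h2 : 1 + K * (b - a) ≤ Real.exp (K * (b - a)) := by
      linarith [Real.add_one_le_exp (K * (b - a))]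
    have h3 : Real.exp (K * (b - t₀)) = Real.exp (K * (b - a)) * Real.exp (K * (a - t₀)) := by
      rw [← Real.exp_add]; congr 1; ring
    have h4 : 1 ≤ Real.exp (K * (b - t₀)) :=
      Real.one_le_exp (mul_nonneg hK (by linarith))
    have h5 : (1 + K * (b - a)) * ‖ξ - η‖ ^ 2 ≤
        Real.exp (K * (b - a)) * (Real.exp (K * (a - t₀)) * ε * (a - t₀)) := by
      gcongr
    have h6 : 1 * (ε * (b - a)) ≤ Real.exp (K * (b - t₀)) * (ε * (b - a)) := by gcongr
    calc _ ≤ Real.exp (K * (b - a)) * (Real.exp (K * (a - t₀)) * ε * (a - t₀)) +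
          Real.exp (K * (b - t₀)) * (ε * (b - a)) := by linarith
      _ = Real.exp (K * (b - t₀)) * ε * (b - t₀) := by rw [h3]; ring

/-- The point at which a player aims. The state `s` of the guide consists of a flag, which is zero
as long as no deviation of the opponent has been observed, of the initial time and state, which
determine the agreed path `Y`, and of a point of the phase space: the predicted state of the system
if the flag is zero, and otherwise the state of the model. -/
noncomputable def aimPoint (Y : ℝ → Vec n → ℝ → Vec n) (t : ℝ) (x : Vec n)
    (s : ℝ × ℝ × Vec n × Vec n) : Vec n :=
  open Classical in
  -- At the first observed deviation the model starts at the actual state, so the distance to it is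
  -- zero.
  if s.1 = 0 then (if x = s.2.2.2 then Y s.2.1 s.2.2.1 t else x) else s.2.2.2

/-- The next state of the guide. -/
noncomputable def nextState (Γ : DifferentialGame n P Q) [MeasurableSpace P] [Nonempty P]
    [Nonempty Q] (c : ℝ → Vec n → ℝ) (Y : ℝ → Vec n → ℝ → Vec n) (t' t : ℝ) (x : Vec n)
    (s : ℝ × ℝ × Vec n × Vec n) : ℝ × ℝ × Vec n × Vec n :=
  open Classical in
  if s.1 = 0 ∧ x = s.2.2.2 then
    (0, s.2.1, s.2.2.1, Γ.prediction t x (aimPoint Y t x s) t')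
  -- The flag is never lowered again.
  else (1, s.2.1, s.2.2.1, Γ.punishment c t x (aimPoint Y t x s) t')

/-- The initial state of the guide. -/
def initialState (t : ℝ) (x : Vec n) : ℝ × ℝ × Vec n × Vec n := (0, t, x, x)

/-- The strategy of player I that follows the agreed path `Y` as long as player II does the same,
and otherwise keeps the function `c` from growing. -/
noncomputable def triggerStrategy (Γ : DifferentialGame n P Q) [MeasurableSpace P] [Nonempty P]
    [Nonempty Q] (c : ℝ → Vec n → ℝ) (Y : ℝ → Vec n → ℝ → Vec n) : GuideStrategy n P :=
  GuideStrategy.ofState (fun t x s => Γ.aimControl t x (x - aimPoint Y t x s)) (Γ.nextState c Y)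
    initialState

theorem aimPoint_of_eq {Y : ℝ → Vec n → ℝ → Vec n} {t t₀ : ℝ} {x x₀ : Vec n} :
    aimPoint Y t x (0, t₀, x₀, x) = Y t₀ x₀ t := by
  simp [aimPoint]

/-- The agreed path `y` from the position `(t₀,x₀)`. -/
structure IsAgreedPath (Γ : DifferentialGame n P Q) (c₁ c₂ : ℝ → Vec n → ℝ) (t₀ : ℝ) (x₀ : Vec n)
    (y : ℝ → Vec n) : Prop where
  apply_start : y t₀ = x₀
  c₁_eq : ∀ t ∈ Icc t₀ Γ.T, c₁ t (y t) = c₁ t₀ x₀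
  c₂_eq : ∀ t ∈ Icc t₀ Γ.T, c₂ t (y t) = c₂ t₀ x₀
  mem_arcs : ∀ a b, t₀ ≤ a → a ≤ b → b ≤ Γ.T → (y a, y b) ∈ closure (Γ.arcs univ a b)

theorem arcs_swap (Γ : DifferentialGame n P Q) (a b : ℝ) :
    Γ.swap.arcs univ a b = Γ.arcs univ a b := by
  ext q
  simp only [arcs, mem_univ, implies_true, and_true, mem_ofPred_eq]
  rw [exists_comm]
  simp only [isMotion_swap]

theorem IsAgreedPath.swap {Γ : DifferentialGame n P Q} {c₁ c₂ : ℝ → Vec n → ℝ} {t₀ : ℝ}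
    {x₀ : Vec n} {y : ℝ → Vec n} (h : Γ.IsAgreedPath c₁ c₂ t₀ x₀ y) :
    Γ.swap.IsAgreedPath c₂ c₁ t₀ x₀ y :=
  ⟨h.apply_start, h.c₂_eq, h.c₁_eq, fun a b h1 h2 h3 => by
    rw [arcs_swap]; exact h.mem_arcs a b h1 h2 h3⟩

theorem exists_isAgreedPath {Γ : DifferentialGame n P Q} [MeasurableSpace P] [MeasurableSpace Q]
    {c₁ c₂ : ℝ → Vec n → ℝ}
    (hF4 : ∀ t₀ ∈ Icc 0 Γ.T, ∀ x₀ : Vec n, ∃ y ∈ Γ.sol t₀ x₀,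
      ∀ t : Icc (0 : ℝ) Γ.T, t₀ ≤ t → c₁ t (y t) = c₁ t₀ x₀ ∧ c₂ t (y t) = c₂ t₀ x₀) :
    ∃ Y : ℝ → Vec n → ℝ → Vec n, ∀ t₀ ∈ Icc 0 Γ.T, ∀ x₀, Γ.IsAgreedPath c₁ c₂ t₀ x₀ (Y t₀ x₀) := by
  have : ∀ (t₀ : ℝ) (x₀ : Vec n), ∃ y : ℝ → Vec n, t₀ ∈ Icc 0 Γ.T →
      Γ.IsAgreedPath c₁ c₂ t₀ x₀ y := fun t₀ x₀ => by
    by_cases ht₀ : t₀ ∈ Icc 0 Γ.T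
    · obtain ⟨y, hy, hyc⟩ := hF4 t₀ ht₀ x₀
      have hproj : ∀ t (ht : t ∈ Icc 0 Γ.T), y (projIcc 0 Γ.T Γ.T_pos.le t) = y ⟨t, ht⟩ :=
        fun t ht => by rw [projIcc_of_mem _ ht]
      have hsub : ∀ t ∈ Icc t₀ Γ.T, t ∈ Icc 0 Γ.T := fun t ht => ⟨ht₀.1.trans ht.1, ht.2⟩
      refine ⟨fun t => y (projIcc 0 Γ.T Γ.T_pos.le t), fun _ => ⟨?_, fun t ht => ?_,
        fun t ht => ?_, fun a b h1 h2 h3 => ?_⟩⟩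
      · rw [hproj t₀ ht₀, apply_of_mem_sol hy ht₀]
      · rw [hproj t (hsub t ht)]
        exact (hyc ⟨t, hsub t ht⟩ ht.1).1
      · rw [hproj t (hsub t ht)]
        exact (hyc ⟨t, hsub t ht⟩ ht.1).2
      · rw [hproj a (hsub a ⟨h1, h2.trans h3⟩), hproj b (hsub b ⟨h1.trans h2, h3⟩)]
        exact mem_closure_arcs_of_mem_sol hy ht₀ (a := ⟨a, hsub a ⟨h1, h2.trans h3⟩⟩)
          (b := ⟨b, hsub b ⟨h1.trans h2, h3⟩⟩) h2
    -- A dummy path for initial times outside `[0,T]`.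
    · exact ⟨fun _ => x₀, fun h => absurd h ht₀⟩
  choose Y hY using this
  exact ⟨Y, fun t₀ ht₀ x₀ => hY t₀ x₀ ht₀⟩

/-- A bound on the states that can be reached from `x₀`. -/
theorem exists_radius (Γ : DifferentialGame n P Q) (t₀ : ℝ) (ht₀ : 0 ≤ t₀) (x₀ : Vec n) :
    ∃ B : ℝ → ℝ, ∃ R, B t₀ = ‖x₀‖ ∧ (∀ t ∈ Icc t₀ Γ.T, B t ≤ R) ∧
      ∀ (a b : ℝ) (A : Set (P × Q)) (q : Vec n × Vec n), t₀ ≤ a → a ≤ b → b ≤ Γ.T →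
        q ∈ closure (Γ.arcs A a b) → ‖q.1‖ ≤ B a → ‖q.2‖ ≤ B b := by
  obtain ⟨C, hC, hgr⟩ := Γ.exists_growth
  -- The exponentials of consecutive intervals multiply, so this bound survives the concatenation of
  -- any number of arcs, as needed for a model that is chosen anew at each step.
  refine ⟨fun t => (1 + ‖x₀‖) * Real.exp (C * (t - t₀)) - 1,
    (1 + ‖x₀‖) * Real.exp (C * Γ.T) - 1, by simp, fun t ht => ?_,
    fun a b A q ha hab hb hq hqa => ?_⟩
  · have : t - t₀ ≤ Γ.T := by linarith [ht.2]
    change (1 + ‖x₀‖) * Real.exp (C * (t - t₀)) - 1 ≤ _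
    gcongr
  · have h1 := growth_of_mem_closure_arcs hq (ht₀.trans ha) hab hb hC hgr
    have h2 : 1 + ‖q.1‖ ≤ (1 + ‖x₀‖) * Real.exp (C * (a - t₀)) := by linarith
    have h3 := mul_le_mul_of_nonneg_right h2 (Real.exp_pos (C * (b - a))).le
    have h4 : Real.exp (C * (b - t₀)) = Real.exp (C * (a - t₀)) * Real.exp (C * (b - a)) := by
      rw [← Real.exp_add]; congr 1; ring
    rw [mul_assoc, ← h4] at h3
    linarith

theorem IsMotion.mem_arcs {Γ : DifferentialGame n P Q} {a b : ℝ} {ξ : Vec n}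
    {u : ℝ → P} {v : ℝ → Q} {x : ℝ → Vec n} (h : Γ.IsMotion (Icc a b) a ξ u v x) :
    (ξ, x b) ∈ closure (Γ.arcs univ a b) :=
  subset_closure ⟨u, v, x, h, rfl, fun _ => mem_univ _⟩

theorem exists_modulus_of_continuousOn {T : ℝ} {c : ℝ → Vec n → ℝ}
    (hc : ContinuousOn (fun p : ℝ × Vec n => c p.1 p.2) (Icc 0 T ×ˢ univ)) (R : ℝ) {ε : ℝ}
    (hε : 0 < ε) : ∃ θ > 0, ∀ t ∈ Icc 0 T, ∀ x y : Vec n, ‖x‖ ≤ R → ‖y‖ ≤ R → ‖x - y‖ ≤ θ →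
      |c t x - c t y| ≤ ε := by
  have hK : IsCompact (Icc 0 T ×ˢ Metric.closedBall (0 : Vec n) R) :=
    isCompact_Icc.prod (isCompact_closedBall _ _)
  have := hK.uniformContinuousOn_of_continuous (hc.mono (prod_mono_right (subset_univ _)))
  rw [Metric.uniformContinuousOn_iff] at this
  obtain ⟨δ, hδ, h⟩ := this ε hε
  refine ⟨δ / 2, half_pos hδ, fun t ht x y hx hy hxy => ?_⟩
  have := h (t, x) ⟨ht, by simpa using hx⟩ (t, y) ⟨ht, by simpa using hy⟩ (by
    rw [Prod.dist_eq, max_lt_iff, dist_eq_norm x y]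
    exact ⟨by simpa using hδ, by linarith⟩)
  exact this.le

/-- This controls the one step in which a deviation takes place before it can be observed. -/
theorem exists_displacement (Γ : DifferentialGame n P Q) (R : ℝ) : ∃ M : ℝ, 0 ≤ M ∧
    ∀ (a b : ℝ) (A : Set (P × Q)) (q : Vec n × Vec n), 0 ≤ a → a ≤ b → b ≤ Γ.T →
      q ∈ closure (Γ.arcs A a b) → ‖q.1‖ ≤ R → ‖q.2 - q.1‖ ≤ M * (b - a) := by
  obtain ⟨M, hM, R', -, hsp⟩ := Γ.exists_speed (R + 1)
  refine ⟨M, hM, fun a b A q ha hab hb hq hqR => ?_⟩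
  obtain ⟨p, hp, hlim⟩ := mem_closure_iff_seq_limit.1 hq
  have h1 : Tendsto (fun i => (p i).1) atTop (𝓝 q.1) := (continuous_fst.tendsto _).comp hlim
  have h2 : Tendsto (fun i => (p i).2) atTop (𝓝 q.2) := (continuous_snd.tendsto _).comp hlim
  refine le_of_tendsto (h2.sub h1).norm ?_
  filter_upwards [h1.norm.eventually_lt_const (show ‖q.1‖ < R + 1 by linarith)] with i hi
  obtain ⟨u, v, z, hz, hzb, -⟩ := hp i
  have := (hsp a b (p i).1 u v z ha hab hb hz hi.le b ⟨hab, le_rfl⟩).2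
  rwa [hzb] at this

/-! ### Deviations from the agreement -/

/-- What player II can obtain against the trigger strategy of player I. -/
theorem triggerStrategy_bound (Γ : DifferentialGame n P Q) [CompactSpace P] [CompactSpace Q]
    [Nonempty P] [Nonempty Q] [MeasurableSpace P] {c₁ c₂ : ℝ → Vec n → ℝ}
    (hc₂ : ContinuousOn (fun p : ℝ × Vec n => c₂ p.1 p.2) (Icc 0 Γ.T ×ˢ univ))
    (hF3 : ∀ t₀ ∈ Icc 0 Γ.T, ∀ (x₀ : Vec n) (v : Q), ∃ y ∈ Γ.sol₁ t₀ x₀ v,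
      ∀ t : Icc (0 : ℝ) Γ.T, t₀ ≤ t → c₂ t (y t) ≤ c₂ t₀ x₀)
    {Y : ℝ → Vec n → ℝ → Vec n} {t₀ : ℝ} (ht₀ : t₀ ∈ Icc 0 Γ.T) {x₀ : Vec n}
    (hY : Γ.IsAgreedPath c₁ c₂ t₀ x₀ (Y t₀ x₀)) {ε : ℝ} (hε : 0 < ε) :
    ∃ δ > 0, ∀ (Δ : TimePartition t₀ Γ.T) (v : ℝ → Q) (x : ℝ → Vec n), Δ.mesh ≤ δ →
      Γ.IsStepMotion₁ t₀ x₀ (Γ.triggerStrategy c₂ Y) Δ v x → c₂ Γ.T (x Γ.T) ≤ c₂ t₀ x₀ + ε := by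
  obtain ⟨B, R, hB₀, hBR, hB⟩ := Γ.exists_radius t₀ ht₀.1 x₀
  obtain ⟨θ, hθ, hmod⟩ := exists_modulus_of_continuousOn hc₂ R (half_pos hε)
  obtain ⟨E, δ₁, hδ₁, hE, hstep⟩ := Γ.exists_tolerance R ht₀.1 (half_pos hθ)
  obtain ⟨δ₂, hδ₂, hpred⟩ := Γ.exists_motion_prediction
  obtain ⟨M, hM, hdisp⟩ := Γ.exists_displacement R
  -- Aiming keeps the predicted state within `θ / 2` of the path. In one step with an arbitrary
  -- control of player II the system and the path move by at most `θ / 4` each, so the actual state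
  -- stays within `θ`.
  refine ⟨min (min δ₁ δ₂) (θ / 4 / (M + 1)), by positivity, fun Δ v x hmesh hstepMotion => ?_⟩
  obtain ⟨u, hu, hx⟩ := hstepMotion
  have hu' := GuideStrategy.forms_ofState_iff.1 hu
  set y := Y t₀ x₀ with hy
  set S := GuideStrategy.states (Γ.nextState c₂ Y) initialState Δ.t x with hS
  have hx₀ : x t₀ = x₀ := hx.apply_start ⟨le_rfl, ht₀.2⟩
  have hxB : ∀ t ∈ Icc t₀ Γ.T, ‖x t‖ ≤ B t := fun t ht =>
    hB t₀ t univ (x t₀, x t) le_rfl ht.1 ht.2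
      (hx.restrict ⟨le_rfl, ht₀.2⟩ le_rfl ht.1 ht.2).mem_arcs (by rw [hB₀, hx₀])
  have hyB : ∀ t ∈ Icc t₀ Γ.T, ‖y t‖ ≤ B t := fun t ht =>
    hB t₀ t univ (y t₀, y t) le_rfl ht.1 ht.2 (hY.mem_arcs t₀ t le_rfl ht.1 ht.2)
      (by rw [hB₀, hY.apply_start])
  have hEθ : ∀ t ∈ Icc t₀ Γ.T, ∀ p : Vec n, ‖p‖ ^ 2 ≤ E t → ‖p‖ ≤ θ / 2 := fun t ht p hp =>
    (sq_le_sq₀ (norm_nonneg p) (half_pos hθ).le).1 (hp.trans (hE t ht).2)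
  have hmem : ∀ k ≤ Δ.r, Δ.t k ∈ Icc t₀ Γ.T := fun k hk => ⟨Δ.left_le hk, Δ.le_right hk⟩
  have hmem0 : ∀ t ∈ Icc t₀ Γ.T, t ∈ Icc 0 Γ.T := fun t ht => ⟨ht₀.1.trans ht.1, ht.2⟩
  -- With the flag down, the fine tolerance is claimed for the predicted state and only the coarse
  -- one for the actual state, which may already result from an unobserved deviation. With the flag
  -- up, the system follows the model, on which `c₂` has not grown.
  have hinv : ∀ k ≤ Δ.r,
      ((S k).1 = 0 ∧ (S k).2.1 = t₀ ∧ (S k).2.2.1 = x₀ ∧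
        ‖(S k).2.2.2 - y (Δ.t k)‖ ^ 2 ≤ E (Δ.t k) ∧ ‖x (Δ.t k) - y (Δ.t k)‖ ≤ θ) ∨
      ((S k).1 ≠ 0 ∧ ‖x (Δ.t k) - (S k).2.2.2‖ ^ 2 ≤ E (Δ.t k) ∧
        c₂ (Δ.t k) (S k).2.2.2 ≤ c₂ t₀ x₀ + ε / 2 ∧ ‖(S k).2.2.2‖ ≤ B (Δ.t k)) := by
    intro k
    induction k with
    | zero =>
      intro _
      left
      have hS0 : S 0 = (0, Δ.t 0, x (Δ.t 0), x (Δ.t 0)) := rfl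
      rw [hS0, Δ.t_zero, hx₀, hY.apply_start]
      refine ⟨rfl, rfl, rfl, ?_, by simpa using hθ.le⟩
      simpa using (hE t₀ ⟨le_rfl, ht₀.2⟩).1
    | succ k ih =>
      intro hk
      have hkr : k ≤ Δ.r := by omega
      set a := Δ.t k with ha
      set b := Δ.t (k + 1) with hb
      have haI := hmem k hkr
      have hbI := hmem (k + 1) hk
      have ha0 := hmem0 a haI
      have hab : a ≤ b := (Δ.t_lt k hk).le
      have hlen := (Δ.step_le_mesh hk).trans hmesh
      have hlen₁ : b - a ≤ δ₁ := hlen.trans ((min_le_left _ _).trans (min_le_left _ _))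
      have hlen₂ : b - a ≤ δ₂ := hlen.trans ((min_le_left _ _).trans (min_le_right _ _))
      have hlenM : M * (b - a) ≤ θ / 4 := by
        have h1 := hlen.trans (min_le_right _ _)
        rw [le_div_iff₀ (by positivity)] at h1
        nlinarith
      have hxab : Γ.IsMotion (Icc a b) a (x a) u v x :=
        hx.restrict ⟨le_rfl, ht₀.2⟩ haI.1 hab hbI.2
      have hctl := hu' k hk
      have hnext : S (k + 1) = Γ.nextState c₂ Y b a (x a) (S k) := rfl
      have hpun : ∀ w : Vec n, aimPoint Y a (x a) (S k) = w → ‖w‖ ≤ B a →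
          ‖x a - w‖ ^ 2 ≤ E a → c₂ a w ≤ c₂ t₀ x₀ + ε / 2 →
          ‖x b - Γ.punishment c₂ a (x a) w b‖ ^ 2 ≤ E b ∧
            c₂ b (Γ.punishment c₂ a (x a) w b) ≤ c₂ t₀ x₀ + ε / 2 ∧
            ‖Γ.punishment c₂ a (x a) w b‖ ≤ B b := by
        intro w hw hwB hwE hwc
        obtain ⟨hp1, hp2⟩ := punishment_spec hF3 ha0.1 hab hbI.2 (x a) w
        refine ⟨hstep a b _ _ _ _ haI.1 hab hbI.2 hlen₁ ((hxB a haI).trans (hBR a haI))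
          (hwB.trans (hBR a haI)) (aimStep_of_mem_arcs ha0 hxab (fun s hs => ?_) hp2) hwE,
          hp1.trans hwc, hB a b _ (w, Γ.punishment c₂ a (x a) w b) haI.1 hab hbI.2 hp2 hwB⟩
        rw [← hw]
        exact hctl s hs
      rcases ih hkr with ⟨h1, h2, h3, h4, h5⟩ | ⟨h1, h2, h3, h4⟩
      · by_cases hxz : x a = (S k).2.2.2
        · left
          have haim : aimPoint Y a (x a) (S k) = y a := by
            simp only [aimPoint, h1, hxz, h2, h3, if_true, hy]
          rw [hnext, nextState, if_pos ⟨h1, hxz⟩, haim]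
          rw [← hxz] at h4
          refine ⟨rfl, h2, h3, ?_, ?_⟩
          · have hya := hY.mem_arcs a b haI.1 hab hbI.2
            exact hstep a b _ _ _ _ haI.1 hab hbI.2 hlen₁ ((hxB a haI).trans (hBR a haI))
              ((hyB a haI).trans (hBR a haI)) (Γ.aimStep_prediction ha0
                (hpred a b ha0.1 hab hbI.2 hlen₂ _ _) hya) h4
          · have d1 := hEθ a haI _ h4
            have d2 := hdisp a b univ _ ha0.1 hab hbI.2 hxab.mem_arcs
              ((hxB a haI).trans (hBR a haI))
            have d3 := hdisp a b univ _ ha0.1 hab hbI.2 (hY.mem_arcs a b haI.1 hab hbI.2)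
              ((hyB a haI).trans (hBR a haI))
            have : x b - y b = (x a - y a) + ((x b - x a) - (y b - y a)) := by abel
            rw [this]
            have d4 := norm_add_le (x a - y a) ((x b - x a) - (y b - y a))
            have d5 := norm_sub_le (x b - x a) (y b - y a)
            simp only at d2 d3
            linarith
        · right
          have haim : aimPoint Y a (x a) (S k) = x a := by
            simp only [aimPoint, h1, hxz, if_true, if_false]
          rw [hnext, nextState, if_neg fun h => hxz h.2, haim]
          -- The only increase of the value: the deviation is observed within `θ` of the path.
          -- Afterwards the value does not grow along the model.
          have hcx : c₂ a (x a) ≤ c₂ t₀ x₀ + ε / 2 := by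
            have := hmod a ha0 _ _ ((hxB a haI).trans (hBR a haI))
              ((hyB a haI).trans (hBR a haI)) h5
            rw [hY.c₂_eq a haI, abs_le] at this
            linarith [this.2]
          exact ⟨one_ne_zero, hpun (x a) haim (hxB a haI) (by simpa using (hE a haI).1) hcx⟩
      · right
        have haim : aimPoint Y a (x a) (S k) = (S k).2.2.2 := by
          simp only [aimPoint, h1, if_false]
        rw [hnext, nextState, if_neg fun h => h1 h.1, haim]
        exact ⟨one_ne_zero, hpun _ haim h4 h2 h3⟩
  have hT : Γ.T ∈ Icc t₀ Γ.T := ⟨ht₀.2, le_rfl⟩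
  have hfin := hinv Δ.r le_rfl
  rw [Δ.t_last] at hfin
  -- A deviation in the last step is never answered, but ends within `θ` of the path.
  rcases hfin with ⟨-, -, -, -, h5⟩ | ⟨-, h2, h3, h4⟩
  · have := hmod Γ.T (hmem0 _ hT) _ _ ((hxB _ hT).trans (hBR _ hT))
      ((hyB _ hT).trans (hBR _ hT)) h5
    rw [hY.c₂_eq _ hT, abs_le] at this
    linarith [this.2]
  · have := hmod Γ.T (hmem0 _ hT) _ _ ((hxB _ hT).trans (hBR _ hT))
      (h4.trans (hBR _ hT)) ((hEθ _ hT _ h2).trans (by linarith))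
    rw [abs_le] at this
    linarith [this.2]

/-! ### Joint motions -/

/-- A motion along which both players aim at the agreed path leaves the guide in the state without
observed deviations. -/
theorem states_eq (Γ : DifferentialGame n P Q) [Nonempty P] [Nonempty Q] [MeasurableSpace P]
    {c : ℝ → Vec n → ℝ} {Y : ℝ → Vec n → ℝ → Vec n}
    {t₀ : ℝ} {x₀ : Vec n} {t : ℕ → ℝ} {x : ℝ → Vec n} (ht : t 0 = t₀) (hx₀ : x t₀ = x₀) {k : ℕ}
    (h : ∀ j < k, x (t (j + 1)) = Γ.prediction (t j) (x (t j)) (Y t₀ x₀ (t j)) (t (j + 1))) :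
    GuideStrategy.states (Γ.nextState c Y) initialState t x k = (0, t₀, x₀, x (t k)) := by
  induction k with
  | zero => simp [GuideStrategy.states, initialState, ht, hx₀]
  | succ k ih =>
    rw [GuideStrategy.states, ih fun j hj => h j (by omega), nextState, aimPoint_of_eq,
      if_pos ⟨rfl, rfl⟩, ← h k (by omega)]

/-- Along a joint motion both players aim at the agreed path. -/
theorem IsJointMotion.prediction {Γ : DifferentialGame n P Q} [Nonempty P] [Nonempty Q]
    [MeasurableSpace P] [MeasurableSpace Q] {c₁ c₂ : ℝ → Vec n → ℝ}
    {Y : ℝ → Vec n → ℝ → Vec n} {t₀ : ℝ} (ht₀ : t₀ ∈ Icc 0 Γ.T) {x₀ : Vec n}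
    {Δ : TimePartition t₀ Γ.T} {x : ℝ → Vec n}
    (h : Γ.IsJointMotion t₀ x₀ (Γ.triggerStrategy c₂ Y) (Γ.swap.triggerStrategy c₁ Y) Δ x) :
    ∀ k < Δ.r, x (Δ.t (k + 1)) =
      Γ.prediction (Δ.t k) (x (Δ.t k)) (Y t₀ x₀ (Δ.t k)) (Δ.t (k + 1)) := by
  obtain ⟨u, v, hu, hv, hx⟩ := h
  have hu' := GuideStrategy.forms_ofState_iff.1 hu
  have hv' := GuideStrategy.forms_ofState_iff.1 hv
  have hx₀ : x t₀ = x₀ := hx.apply_start ⟨le_rfl, ht₀.2⟩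
  intro k
  induction k using Nat.strong_induction_on with
  -- The state of the guide at step `k` depends on all the earlier comparisons, hence strong
  -- induction.
  | _ k ih =>
    intro hk
    have hprev : ∀ j < k, x (Δ.t (j + 1)) =
        Γ.prediction (Δ.t j) (x (Δ.t j)) (Y t₀ x₀ (Δ.t j)) (Δ.t (j + 1)) :=
      fun j hj => ih j hj (hj.trans hk)
    have hk0 := Δ.left_le hk.le
    have hkk := (Δ.t_lt k hk).le
    refine (hx.restrict ⟨le_rfl, ht₀.2⟩ hk0 hkk (Δ.le_right hk)).eq_prediction
      (ht₀.1.trans hk0) hkk (Δ.le_right hk) (fun s hs => ?_) (fun s hs => ?_)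
    · rw [hu' k hk s hs, Γ.states_eq Δ.t_zero hx₀ hprev, aimPoint_of_eq]
    · rw [← prediction_swap] at hprev
      rw [hv' k hk s hs, Γ.swap.states_eq Δ.t_zero hx₀ hprev, aimPoint_of_eq]

/-- The joint motions follow the agreed path. -/
theorem jointMotion_bound (Γ : DifferentialGame n P Q) [CompactSpace P] [CompactSpace Q]
    [Nonempty P] [Nonempty Q] [MeasurableSpace P] [MeasurableSpace Q] {c₁ c₂ : ℝ → Vec n → ℝ}
    {Y : ℝ → Vec n → ℝ → Vec n} {t₀ : ℝ} (ht₀ : t₀ ∈ Icc 0 Γ.T) {x₀ : Vec n}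
    (hY : Γ.IsAgreedPath c₁ c₂ t₀ x₀ (Y t₀ x₀)) {θ : ℝ} (hθ : 0 < θ) :
    ∃ δ > 0, ∀ (Δ : TimePartition t₀ Γ.T) (x : ℝ → Vec n), Δ.mesh ≤ δ →
      Γ.IsJointMotion t₀ x₀ (Γ.triggerStrategy c₂ Y) (Γ.swap.triggerStrategy c₁ Y) Δ x →
      ‖x Γ.T - Y t₀ x₀ Γ.T‖ ≤ θ := by
  obtain ⟨B, R, hB₀, hBR, hB⟩ := Γ.exists_radius t₀ ht₀.1 x₀
  obtain ⟨E, δ₁, hδ₁, hE, hstep⟩ := Γ.exists_tolerance R ht₀.1 hθ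
  obtain ⟨δ₂, hδ₂, hpred⟩ := Γ.exists_motion_prediction
  refine ⟨min δ₁ δ₂, lt_min hδ₁ hδ₂, fun Δ x hmesh hjoint => ?_⟩
  have hp := hjoint.prediction ht₀
  obtain ⟨u, v, -, -, hx⟩ := hjoint
  set y := Y t₀ x₀ with hy
  have hx₀ : x t₀ = x₀ := hx.apply_start ⟨le_rfl, ht₀.2⟩
  have hxR : ∀ t ∈ Icc t₀ Γ.T, ‖x t‖ ≤ R := fun t ht =>
    (hB t₀ t univ (x t₀, x t) le_rfl ht.1 ht.2 (hx.restrict ⟨le_rfl, ht₀.2⟩ le_rfl ht.1 ht.2).mem_arcs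
      (by rw [hx₀, hB₀])).trans (hBR t ht)
  have hyR : ∀ t ∈ Icc t₀ Γ.T, ‖y t‖ ≤ R := fun t ht =>
    (hB t₀ t univ (y t₀, y t) le_rfl ht.1 ht.2 (hY.mem_arcs t₀ t le_rfl ht.1 ht.2)
      (by rw [hY.apply_start, hB₀])).trans (hBR t ht)
  have hinv : ∀ k ≤ Δ.r, ‖x (Δ.t k) - y (Δ.t k)‖ ^ 2 ≤ E (Δ.t k) := by
    intro k
    induction k with
    | zero =>
      intro _
      rw [Δ.t_zero, hx₀, hY.apply_start]
      simpa using (hE t₀ ⟨le_rfl, ht₀.2⟩).1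
    | succ k ih =>
      intro hk
      have haI : Δ.t k ∈ Icc t₀ Γ.T := ⟨Δ.left_le (by omega), Δ.le_right (by omega)⟩
      have hb := Δ.le_right hk
      have hab := (Δ.t_lt k hk).le
      have hlen := (Δ.step_le_mesh hk).trans hmesh
      have ha0 : Δ.t k ∈ Icc 0 Γ.T := ⟨ht₀.1.trans haI.1, haI.2⟩
      rw [hp k hk]
      exact hstep _ _ _ _ _ _ haI.1 hab hb (hlen.trans (min_le_left _ _)) (hxR _ haI) (hyR _ haI)
        (Γ.aimStep_prediction ha0
          (hpred _ _ ha0.1 hab hb (hlen.trans (min_le_right _ _)) _ _)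
          (hY.mem_arcs _ _ haI.1 hab hb)) (ih (by omega))
  have := hinv Δ.r le_rfl
  rw [Δ.t_last] at this
  exact (sq_le_sq₀ (norm_nonneg _) hθ.le).1 (this.trans (hE _ ⟨ht₀.2, le_rfl⟩).2)

/-- There are joint motions for every fine partition. -/
theorem exists_isJointMotion (Γ : DifferentialGame n P Q) [Nonempty P] [Nonempty Q]
    [MeasurableSpace P] [MeasurableSpace Q] (c₁ c₂ : ℝ → Vec n → ℝ)
    (Y : ℝ → Vec n → ℝ → Vec n) : ∃ h > 0, ∀ t₀ ∈ Icc 0 Γ.T, ∀ (x₀ : Vec n)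
      (Δ : TimePartition t₀ Γ.T), Δ.mesh ≤ h → ∃ x : ℝ → Vec n,
        Γ.IsJointMotion t₀ x₀ (Γ.triggerStrategy c₂ Y) (Γ.swap.triggerStrategy c₁ Y) Δ x := by
  obtain ⟨h, hh, H⟩ := Γ.exists_stepwise
  refine ⟨h, hh, fun t₀ ht₀ x₀ Δ hmesh => ?_⟩
  -- The motion is built from the feedback that aims at the agreed path without any guide; the
  -- predictions then come true along it, so the guided strategies form the same controls.
  obtain ⟨u, v, x, hx, huv⟩ := H t₀ x₀ Δ (fun t x => Γ.aimControl t x (x - Y t₀ x₀ t))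
    (fun t x => Γ.swap.aimControl t x (x - Y t₀ x₀ t)) ht₀.1 hmesh
  have hx₀ : x t₀ = x₀ := hx.apply_start ⟨le_rfl, ht₀.2⟩
  have hp : ∀ k < Δ.r, x (Δ.t (k + 1)) =
      Γ.prediction (Δ.t k) (x (Δ.t k)) (Y t₀ x₀ (Δ.t k)) (Δ.t (k + 1)) := fun k hk => by
    have hk0 := Δ.left_le hk.le
    have hkk := (Δ.t_lt k hk).le
    exact (hx.restrict ⟨le_rfl, ht₀.2⟩ hk0 hkk (Δ.le_right hk)).eq_prediction
      (ht₀.1.trans hk0) hkk (Δ.le_right hk) (fun s hs => (huv k hk s hs).1)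
      (fun s hs => (huv k hk s hs).2)
  refine ⟨x, u, v, GuideStrategy.forms_ofState_iff.2 fun k hk s hs => ?_,
    GuideStrategy.forms_ofState_iff.2 fun k hk s hs => ?_, hx⟩
  · rw [Γ.states_eq Δ.t_zero hx₀ fun j hj => hp j (hj.trans hk), aimPoint_of_eq]
    exact (huv k hk s hs).1
  · rw [← prediction_swap] at hp
    rw [Γ.swap.states_eq Δ.t_zero hx₀ fun j hj => hp j (hj.trans hk), aimPoint_of_eq]
    exact (huv k hk s hs).2

/-! ### Limits of the payoffs and the equilibrium -/

theorem hasPayoff_of_bound (Γ : DifferentialGame n P Q) {σ : Vec n → ℝ} {t₀ : ℝ} {x₀ : Vec n}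
    {U : GuideStrategy n P} {V : GuideStrategy n Q} {c h : ℝ} (hh : 0 < h) (ht₀ : t₀ ≤ Γ.T)
    (hex : ∀ Δ : TimePartition t₀ Γ.T, Δ.mesh ≤ h → ∃ x, Γ.IsJointMotion t₀ x₀ U V Δ x)
    (hb : ∀ ε > 0, ∃ δ > 0, ∀ (Δ : TimePartition t₀ Γ.T) (x : ℝ → Vec n), Δ.mesh ≤ δ →
      Γ.IsJointMotion t₀ x₀ U V Δ x → |σ (x Γ.T) - c| ≤ ε) :
    Γ.HasPayoff σ t₀ x₀ U V c := by
  -- Without a joint motion the infimum would be `⊤` and the supremum `⊥`.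
  have hne : ∀ δ > 0, (Γ.jointPayoffs σ t₀ x₀ U V δ).Nonempty := fun δ hδ => by
    obtain ⟨Δ, hΔ⟩ := TimePartition.exists_mesh_le ht₀ (lt_min hδ hh)
    obtain ⟨x, hx⟩ := hex Δ (hΔ.trans (min_le_right _ _))
    exact ⟨_, Δ, x, hΔ.trans (min_le_left _ _), hx, rfl⟩
  have hev : ∀ ε > 0, ∀ᶠ δ in 𝓝[>] (0 : ℝ), ((c - ε : ℝ) : EReal) ≤
      sInf (Γ.jointPayoffs σ t₀ x₀ U V δ) ∧
      sInf (Γ.jointPayoffs σ t₀ x₀ U V δ) ≤ sSup (Γ.jointPayoffs σ t₀ x₀ U V δ) ∧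
      sSup (Γ.jointPayoffs σ t₀ x₀ U V δ) ≤ ((c + ε : ℝ) : EReal) := fun ε hε => by
    obtain ⟨δ, hδ, H⟩ := hb ε hε
    filter_upwards [Ioo_mem_nhdsGT hδ] with δ' hδ'
    refine ⟨le_sInf ?_, sInf_le_sSup (hne δ' hδ'.1), sSup_le ?_⟩
    · rintro p ⟨Δ, x, hΔ, hx, rfl⟩
      have := abs_le.1 (H Δ x (hΔ.trans hδ'.2.le) hx)
      exact EReal.coe_le_coe_iff.2 (by linarith [this.1])
    · rintro p ⟨Δ, x, hΔ, hx, rfl⟩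
      have := abs_le.1 (H Δ x (hΔ.trans hδ'.2.le) hx)
      exact EReal.coe_le_coe_iff.2 (by linarith [this.2])
  have hlow : ∀ a : EReal, a < c → ∃ ε > 0, a < ((c - ε : ℝ) : EReal) := fun a ha => by
    obtain ⟨r, hr1, hr2⟩ := EReal.lt_iff_exists_real_btwn.1 ha
    exact ⟨c - r, sub_pos.2 (EReal.coe_lt_coe_iff.1 hr2), by simpa using hr1⟩
  have hupp : ∀ a : EReal, c < a → ∃ ε > 0, ((c + ε : ℝ) : EReal) < a := fun a ha => by
    obtain ⟨r, hr1, hr2⟩ := EReal.lt_iff_exists_real_btwn.1 ha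
    exact ⟨r - c, sub_pos.2 (EReal.coe_lt_coe_iff.1 hr1), by simpa using hr2⟩
  constructor <;> refine tendsto_order.2 ⟨fun a ha => ?_, fun a ha => ?_⟩
  · obtain ⟨ε, hε, h1⟩ := hlow a ha
    filter_upwards [hev ε hε] with δ hδ using h1.trans_le hδ.1
  · obtain ⟨ε, hε, h1⟩ := hupp a ha
    filter_upwards [hev ε hε] with δ hδ using (hδ.2.1.trans hδ.2.2).trans_lt h1
  · obtain ⟨ε, hε, h1⟩ := hlow a ha
    filter_upwards [hev ε hε] with δ hδ using h1.trans_le (hδ.1.trans hδ.2.1)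
  · obtain ⟨ε, hε, h1⟩ := hupp a ha
    filter_upwards [hev ε hε] with δ hδ using hδ.2.2.trans_lt h1

/-- The upper bound of the payoffs of a deviating player has a limit, which does not exceed `c`
if the payoffs do not exceed `c` asymptotically. -/
theorem exists_tendsto_sSup_le {S : ℝ → Set EReal} (hS : Monotone S) {c : ℝ}
    (hb : ∀ ε > 0, ∃ δ > 0, ∀ p ∈ S δ, p ≤ ((c + ε : ℝ) : EReal)) :
    ∃ a : EReal, Tendsto (fun δ => sSup (S δ)) (𝓝[>] 0) (𝓝 a) ∧ a ≤ c := by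
  have hm : Monotone fun δ => sSup (S δ) := fun _ _ h => sSup_le_sSup (hS h)
  refine ⟨_, hm.tendsto_nhdsGT 0, le_of_forall_gt fun a ha => ?_⟩
  obtain ⟨r, hr1, hr2⟩ := EReal.lt_iff_exists_real_btwn.1 ha
  obtain ⟨δ, hδ, H⟩ := hb (r - c) (sub_pos.2 (EReal.coe_lt_coe_iff.1 hr1))
  refine lt_of_le_of_lt ((sInf_le (mem_image_of_mem _ hδ)).trans (sSup_le H)) ?_
  simpa using hr2

theorem payoffs₁_mono (Γ : DifferentialGame n P Q) [MeasurableSpace Q] (t₀ : ℝ) (x₀ : Vec n)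
    (U : GuideStrategy n P) : Monotone (Γ.payoffs₁ t₀ x₀ U) := by
  rintro δ δ' h p ⟨Δ, v, x, hΔ, hv, hx, rfl⟩
  exact ⟨Δ, v, x, hΔ.trans h, hv, hx, rfl⟩

theorem exists_tendsto_payoffs₁ (Γ : DifferentialGame n P Q) [CompactSpace P] [CompactSpace Q]
    [Nonempty P] [Nonempty Q] [MeasurableSpace P] [MeasurableSpace Q] {c₁ c₂ : ℝ → Vec n → ℝ}
    (hc₂ : ContinuousOn (fun p : ℝ × Vec n => c₂ p.1 p.2) (Icc 0 Γ.T ×ˢ univ))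
    (hF1 : ∀ x, c₂ Γ.T x = Γ.σ₂ x)
    (hF3 : ∀ t₀ ∈ Icc 0 Γ.T, ∀ (x₀ : Vec n) (v : Q), ∃ y ∈ Γ.sol₁ t₀ x₀ v,
      ∀ t : Icc (0 : ℝ) Γ.T, t₀ ≤ t → c₂ t (y t) ≤ c₂ t₀ x₀)
    {Y : ℝ → Vec n → ℝ → Vec n} {t₀ : ℝ} (ht₀ : t₀ ∈ Icc 0 Γ.T) {x₀ : Vec n}
    (hY : Γ.IsAgreedPath c₁ c₂ t₀ x₀ (Y t₀ x₀)) :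
    ∃ a : EReal, Tendsto (fun δ => sSup (Γ.payoffs₁ t₀ x₀ (Γ.triggerStrategy c₂ Y) δ))
      (𝓝[>] 0) (𝓝 a) ∧ a ≤ c₂ t₀ x₀ := by
  refine exists_tendsto_sSup_le (Γ.payoffs₁_mono t₀ x₀ _) fun ε hε => ?_
  obtain ⟨δ, hδ, H⟩ := Γ.triggerStrategy_bound hc₂ hF3 ht₀ hY hε
  refine ⟨δ, hδ, ?_⟩
  rintro p ⟨Δ, v, x, hΔ, -, hx, rfl⟩
  rw [← hF1]
  exact EReal.coe_le_coe_iff.2 (H Δ v x hΔ hx)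

theorem hasPayoff_triggerStrategy (Γ : DifferentialGame n P Q) [CompactSpace P] [CompactSpace Q]
    [Nonempty P] [Nonempty Q] [MeasurableSpace P] [MeasurableSpace Q] {c₁ c₂ : ℝ → Vec n → ℝ}
    {Y : ℝ → Vec n → ℝ → Vec n} {t₀ : ℝ} (ht₀ : t₀ ∈ Icc 0 Γ.T) {x₀ : Vec n}
    (hY : Γ.IsAgreedPath c₁ c₂ t₀ x₀ (Y t₀ x₀)) {σ : Vec n → ℝ} (hσ : Continuous σ) :
    Γ.HasPayoff σ t₀ x₀ (Γ.triggerStrategy c₂ Y) (Γ.swap.triggerStrategy c₁ Y)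
      (σ (Y t₀ x₀ Γ.T)) := by
  obtain ⟨h, hh, hex⟩ := Γ.exists_isJointMotion c₁ c₂ Y
  refine Γ.hasPayoff_of_bound hh ht₀.2 (hex t₀ ht₀ x₀) fun ε hε => ?_
  obtain ⟨θ, hθ, H⟩ := Metric.continuous_iff.1 hσ (Y t₀ x₀ Γ.T) ε hε
  obtain ⟨δ, hδ, H'⟩ := Γ.jointMotion_bound ht₀ hY (half_pos hθ)
  refine ⟨δ, hδ, fun Δ x hΔ hx => ?_⟩
  rw [← Real.dist_eq]
  refine (H _ ?_).le
  rw [dist_eq_norm]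
  linarith [H' Δ x hΔ hx]

end DifferentialGame

theorem mainTheorem3 {n : ℕ} {P Q : Type*}
    [MetricSpace P] [CompactSpace P] [MeasurableSpace P] [BorelSpace P]
    [MetricSpace Q] [CompactSpace Q] [MeasurableSpace Q] [BorelSpace Q]
    (Γ : DifferentialGame n P Q) (c₁ c₂ : ℝ → Vec n → ℝ)
    (hc₁ : ContinuousOn (fun p : ℝ × Vec n => c₁ p.1 p.2) (Icc 0 Γ.T ×ˢ univ))
    (hc₂ : ContinuousOn (fun p : ℝ × Vec n => c₂ p.1 p.2) (Icc 0 Γ.T ×ˢ univ))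
    (hF1 : ∀ x : Vec n, c₁ Γ.T x = Γ.σ₁ x ∧ c₂ Γ.T x = Γ.σ₂ x)
    (hF2 : ∀ t₀ ∈ Icc 0 Γ.T, ∀ (x₀ : Vec n) (u : P), ∃ y ∈ Γ.sol₂ t₀ x₀ u,
      ∀ t : Icc (0 : ℝ) Γ.T, t₀ ≤ t → c₁ t (y t) ≤ c₁ t₀ x₀)
    (hF3 : ∀ t₀ ∈ Icc 0 Γ.T, ∀ (x₀ : Vec n) (v : Q), ∃ y ∈ Γ.sol₁ t₀ x₀ v,
      ∀ t : Icc (0 : ℝ) Γ.T, t₀ ≤ t → c₂ t (y t) ≤ c₂ t₀ x₀)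
    (hF4 : ∀ t₀ ∈ Icc 0 Γ.T, ∀ x₀ : Vec n, ∃ y ∈ Γ.sol t₀ x₀,
      ∀ t : Icc (0 : ℝ) Γ.T, t₀ ≤ t → c₁ t (y t) = c₁ t₀ x₀ ∧ c₂ t (y t) = c₂ t₀ x₀) :
    ∀ G : Set (ℝ × Vec n), IsCompact G → G ⊆ Icc 0 Γ.T ×ˢ univ →
      ∃ (U : GuideStrategy n P) (V : GuideStrategy n Q), Γ.IsGuideNash G U V ∧
        ∀ (t₀ : ℝ) (x₀ : Vec n), (t₀, x₀) ∈ G →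
          Γ.HasPayoff Γ.σ₁ t₀ x₀ U V (c₁ t₀ x₀) ∧ Γ.HasPayoff Γ.σ₂ t₀ x₀ U V (c₂ t₀ x₀) := by
  have hne : Nonempty P ∧ Nonempty Q := by
    -- A nonempty closure comes from a nonempty set, so (F4) provides controls, whose values show
    -- that `P` and `Q` are nonempty.
    obtain ⟨y, hy, -⟩ := hF4 0 ⟨le_rfl, Γ.T_pos.le⟩ 0
    obtain ⟨-, u, v, -⟩ := closure_nonempty_iff.1 ⟨y, hy⟩
    exact ⟨⟨u 0⟩, ⟨v 0⟩⟩
  obtain ⟨hP, hQ⟩ := hne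
  obtain ⟨Y, hY⟩ := DifferentialGame.exists_isAgreedPath hF4
  intro G _ hG
  have hpay : ∀ (t₀ : ℝ) (x₀ : Vec n), (t₀, x₀) ∈ G →
      Γ.HasPayoff Γ.σ₁ t₀ x₀ (Γ.triggerStrategy c₂ Y) (Γ.swap.triggerStrategy c₁ Y) (c₁ t₀ x₀) ∧
      Γ.HasPayoff Γ.σ₂ t₀ x₀ (Γ.triggerStrategy c₂ Y) (Γ.swap.triggerStrategy c₁ Y)
        (c₂ t₀ x₀) := fun t₀ x₀ h => by
    have ht₀ : t₀ ∈ Icc 0 Γ.T := (hG h).1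
    have hT : Γ.T ∈ Icc t₀ Γ.T := ⟨ht₀.2, le_rfl⟩
    have hy := hY t₀ ht₀ x₀
    rw [← hy.c₁_eq _ hT, ← hy.c₂_eq _ hT, (hF1 _).1, (hF1 _).2]
    exact ⟨Γ.hasPayoff_triggerStrategy ht₀ hy Γ.continuous_σ₁,
      Γ.hasPayoff_triggerStrategy ht₀ hy Γ.continuous_σ₂⟩
  refine ⟨Γ.triggerStrategy c₂ Y, Γ.swap.triggerStrategy c₁ Y, fun t₀ x₀ h => ?_, hpay⟩
  have ht₀ : t₀ ∈ Icc 0 Γ.T := (hG h).1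
  have hy := hY t₀ ht₀ x₀
  obtain ⟨a₂, ha₂, hle₂⟩ := Γ.exists_tendsto_payoffs₁ hc₂ (fun x => (hF1 x).2) hF3 ht₀ hy
  -- (F2) is (F3) for the game with the players exchanged.
  obtain ⟨a₁, ha₁, hle₁⟩ := Γ.swap.exists_tendsto_payoffs₁ (c₂ := c₁) hc₁ (fun x => (hF1 x).1)
    (fun t ht x u => by rw [DifferentialGame.sol₁_swap]; exact hF2 t ht x u) ht₀ hy.swap
  simp only [DifferentialGame.payoffs₁_swap] at ha₁
  exact ⟨⟨a₁, _, ha₁, (hpay t₀ x₀ h).1.1, hle₁⟩, ⟨a₂, _, ha₂, (hpay t₀ x₀ h).2.1, hle₂⟩⟩
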